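/- Let $0<a<b$ be real numbers. Let $T_n,U_n$ be the Chebyshev polynomials of the first and second kind, and put $\widehat T_n(x)=T_n\!\left(\frac{2x-(a+b)}{b-a}\right)$, $\widehat U_n(x)=U_n\!\left(\frac{2x-(a+b)}{b-a}\right)$. For a real polynomial $f$ define $$\mathcal V[f]=\frac1{2\pi^2}\int_a^b\frac{f(x)}{\sqrt{(b-x)(x-a)}}\left(\mathrm{P}\!\!\int_a^b\frac{\sqrt{(b-y)(y-a)}}{x-y}\,f'(y)\,dy\right)dx ,$$ where $\mathrm P\!\int$ is the Cauchy principal value integral (this is the large-$N$ limit formula for the variance of $\sum_j f(x_j)$ over the eigenvalues of a unitary-invariant Hermitian random matrix with eigenvalue density supported on $(a,b)$). For $n\ge 0$ let $$\widehat P_n(x)=\frac{2(x+\sqrt{ab})}{\sqrt b+\sqrt a}\,\widehat U_n(x)-(\sqrt b-\sqrt a)\,\widehat T_{n+1}(x).$$ (1) Put $A=\frac{\sqrt b-\sqrt a}{\sqrt{2(b-a)}}$, $B=\frac{\sqrt b+\sqrt a}{\sqrt{2(b-a)}}$, $\rho(\tau)=\tau+\frac{b+a}{b-a}$ and $h(z)=Az+B$.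 Then $h$ has degree $1$, $h(z)\ne0$ for $|z|<1$, $h(0)>0$ and $\rho(\cos\theta)=|h(e^{i\theta})|^2$ for all real $\theta$. The polynomials $P_n(\tau)=\sqrt{2/\pi}\,\left[(A\tau+B)U_n(\tau)-A\,T_{n+1}(\tau)\right]$ satisfy Szegő's formula $$P_n(\cos\theta)=\sqrt{\tfrac2\pi}\left[c(\theta)\frac{\sin(n+1)\theta}{\sin\theta}-s(\theta)\frac{\cos(n+1)\theta}{\sin\theta}\right]\quad(\sin\theta\neq0),\qquad h(e^{i\theta})=c(\theta)+is(\theta),$$ with $c,s$ real, and $\int_{-1}^1P_mP_n\frac{\sqrt{1-\tau^2}}{\rho(\tau)}d\tau=\delta_{mn}$ for all $m,n\ge0$. (2) $\widehat P_n$ has degree $n$, $\widehat P_n(x)=\sqrt{\pi(b-a)}\,P_n\!\left(\frac{2}{b-a}x-\frac{b+a}{b-a}\right)$, and $$\int_a^b\widehat P_m(x)\widehat P_n(x)\frac{\sqrt{(b-x)(x-a)}}{x}\,dx=\frac{\pi(b-a)^2}{2}\,\delta_{mn}\qquad(m,n\ge0).$$ (3) Let $K\ge0$, $c_0,\dots,c_K\in\mathbb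 R$ and $f=\sum_{n=0}^Kc_n\widehat P_n$. Then the principal value exists for every $x\in(a,b)$, the outer integral converges absolutely, and $$\mathcal V[f]=\frac12\sum_{m=1}^K\sum_{n=1}^Kc_mc_nR(m,n),$$ where, with $k=\min(m,n)$, $$R(m,n)=\begin{cases}(b+a)k^2+(\sqrt b+\sqrt a)^2k,& m,n\text{ both even},\\ (b+a)k^2+(\sqrt b+\sqrt a)^2k+2\sqrt{ab},& m,n\text{ both odd},\\ (b-a)(k^2+k),& m,n\text{ of different parity}.\end{cases}$$ (4) Let $M$ be the $K\times K$ upper-triangular Toeplitz matrix with $M_{ij}=t_{j-i}$ for $i\le j$ and $M_{ij}=0$ for $i>j$, where $$t_0=\frac1{\sqrt b+\sqrt a},\qquad t_1=-\frac{\sqrt b-\sqrt a}{(\sqrt b+\sqrt a)^2},\qquad t_j=(-1)^{j-1}\,\frac{4\sqrt{ab}\,(\sqrt b-\sqrt a)^{j-2}}{(\sqrt b+\sqrt a)^{j+1}}\quad(j\ge2).$$ Then $M$ is invertible, and if $(c_1,\dots,c_K)^{T}=M(d_1,\dots,d_K)^{T}$ then $$\mathcal V[f]=\sum_{n=1}^Kn\,d_n^2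 .$$ -/

import Mathlib

open MeasureTheory Filter Topology

noncomputable section

/-- The truncated integral of `g` over `(a, b)`, with `[x - ε, x + ε]` removed. -/
def truncIntegral (a b x : ℝ) (g : ℝ → ℝ) (ε : ℝ) : ℝ :=
  ∫ y in {y : ℝ | y ∈ Set.Ioo a b ∧ ε < |x - y|}, g y

/-- The Cauchy principal value `P ∫_a^b g(y) dy`, with singularity at `x`, exists and equals `L`. -/
def HasPrincipalValue (a b x : ℝ) (g : ℝ → ℝ) (L : ℝ) : Prop :=
  (∀ ε : ℝ, 0 < ε → IntegrableOn g {y : ℝ | y ∈ Set.Ioo a b ∧ ε < |x - y|} volume) ∧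
    Tendsto (truncIntegral a b x g) (𝓝[>] 0) (𝓝 L)

/-- The Cauchy principal value `P ∫_a^b g(y) dy`, with singularity at `x`. -/
def principalValue (a b x : ℝ) (g : ℝ → ℝ) : ℝ :=
  limUnder (𝓝[>] (0 : ℝ)) (truncIntegral a b x g)

/-- The integrand `√((b - y)(y - a)) f'(y) / (x - y)` of the inner integral of the variance. -/
def innerIntegrand (a b : ℝ) (f : ℝ → ℝ) (x y : ℝ) : ℝ :=
  √((b - y) * (y - a)) / (x - y) * deriv f y

/-- The integrand of the outer integral of the variance. -/
def outerIntegrand (a b : ℝ) (f : ℝ → ℝ) (x : ℝ) : ℝ :=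
  f x / √((b - x) * (x - a)) * principalValue a b x (innerIntegrand a b f x)

/-- The limiting variance of the linear statistic of `f`, for eigenvalues supported in `(a, b)`. -/
def variance (a b : ℝ) (f : ℝ → ℝ) : ℝ :=
  1 / (2 * Real.pi ^ 2) * ∫ x in a..b, outerIntegrand a b f x

/-- The double integral defining the variance of `f` makes sense. -/
def VarianceWellDefined (a b : ℝ) (f : ℝ → ℝ) : Prop :=
  (∀ x ∈ Set.Ioo a b, ∃ L : ℝ, HasPrincipalValue a b x (innerIntegrand a b f x) L) ∧
    IntervalIntegrable (outerIntegrand a b f) volume a b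

/-- The affine polynomial `2 x / (b - a) - (b + a) / (b - a)`, mapping `[a, b]` onto `[-1, 1]`. -/
def affinePoly (a b : ℝ) : Polynomial ℝ :=
  Polynomial.C (2 / (b - a)) * Polynomial.X - Polynomial.C ((b + a) / (b - a))

/-- The translated Chebyshev polynomials of the first kind. -/
def hatT (a b : ℝ) (n : ℕ) : Polynomial ℝ :=
  (Polynomial.Chebyshev.T ℝ n).comp (affinePoly a b)

/-- The translated Chebyshev polynomials of the second kind. -/
def hatU (a b : ℝ) (n : ℕ) : Polynomial ℝ :=
  (Polynomial.Chebyshev.U ℝ n).comp (affinePoly a b)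

/-- `P̂_n = 2 (x + √(ab)) / (√b + √a) Û_n - (√b - √a) T̂_{n+1}`. -/
def hatP (a b : ℝ) (n : ℕ) : Polynomial ℝ :=
  Polynomial.C (2 / (√b + √a)) * (Polynomial.X + Polynomial.C (√(a * b))) * hatU a b n -
    Polynomial.C (√b - √a) * hatT a b (n + 1)

/-- The coefficient `A` of `h(z) = A z + B`. -/
def coeffA (a b : ℝ) : ℝ := (√b - √a) / √(2 * (b - a))

/-- The coefficient `B` of `h(z) = A z + B`. -/
def coeffB (a b : ℝ) : ℝ := (√b + √a) / √(2 * (b - a))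

/-- The polynomial `h(z) = A z + B`. -/
def szegoH (a b : ℝ) : Polynomial ℝ :=
  Polynomial.C (coeffA a b) * Polynomial.X + Polynomial.C (coeffB a b)

/-- The value `h(e^{iθ})`. -/
def szegoHCircle (a b θ : ℝ) : ℂ :=
  Polynomial.aeval (Complex.exp (θ * Complex.I)) (szegoH a b)

/-- The polynomials `P_n(τ) = √(2/π) [(A τ + B) U_n(τ) - A T_{n+1}(τ)]` on `[-1, 1]`. -/
def polyP (a b : ℝ) (n : ℕ) : Polynomial ℝ :=
  Polynomial.C (√(2 / Real.pi)) *
    ((Polynomial.C (coeffA a b) * Polynomial.X + Polynomial.C (coeffB a b)) *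
        Polynomial.Chebyshev.U ℝ n -
      Polynomial.C (coeffA a b) * Polynomial.Chebyshev.T ℝ (n + 1))

/-- The matrix `R(m, n)` of the quadratic form, for `m, n ≥ 1`. -/
def kernelR (a b : ℝ) (m n : ℕ) : ℝ :=
  if Even m then
    if Even n then
      if n ≤ m then (b + a) * (n : ℝ) ^ 2 + (√b + √a) ^ 2 * n
      else (b + a) * (m : ℝ) ^ 2 + (√b + √a) ^ 2 * m
    else
      if n < m then (b - a) * ((n : ℝ) ^ 2 + n)
      else (b - a) * ((m : ℝ) ^ 2 + m)
  else
    if Even n then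
      if n < m then (b - a) * ((n : ℝ) ^ 2 + n)
      else (b - a) * ((m : ℝ) ^ 2 + m)
    else
      if n ≤ m then (b + a) * (n : ℝ) ^ 2 + (√b + √a) ^ 2 * n + 2 * √(a * b)
      else (b + a) * (m : ℝ) ^ 2 + (√b + √a) ^ 2 * m + 2 * √(a * b)

/-- The entry on the `k`-th superdiagonal of the Toeplitz matrix. -/
def toeplitzCoeff (a b : ℝ) : ℕ → ℝ
  | 0 => 1 / (√b + √a)
  | 1 => -((√b - √a) / (√b + √a) ^ 2)
  | k + 2 => (-1) ^ (k + 1) * (4 * √(a * b) * (√b - √a) ^ k / (√b + √a) ^ (k + 3))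

/-- The upper-triangular Toeplitz matrix; rows and columns `0, …, K - 1` stand for `1, …, K`. -/
def toeplitzMatrix (a b : ℝ) (K : ℕ) : Matrix (Fin K) (Fin K) ℝ :=
  Matrix.of fun i j =>
    if i ≤ j then toeplitzCoeff a b ((j : ℕ) - (i : ℕ)) else 0

/-- The function `f = ∑_{n=0}^K c_n P̂_n`. -/
def expansion (a b : ℝ) (K : ℕ) (c : ℕ → ℝ) (x : ℝ) : ℝ :=
  ∑ n ∈ Finset.range (K + 1), c n * (hatP a b n).eval x

end

/-! Since `X * U_n - T_{n+1} = U_{n-1}`, both families are multiples of `B U_n + A U_{n-1}`, after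
an affine substitution for `hatP`. Orthogonality and variance are therefore read off from Chebyshev
polynomials.

Orthogonality. Let `Λ` integrate against `√(1 - x²) / (x + κ)`, with `κ = (b + a) / (b - a)`.
Multiplication by `2 (x + κ)` acts on the index of `U_m` as `E + 2κ + E⁻¹`, `E` being the shift. As
`2AB = 1` and `A² + B² = κ`, this factors as `2 (A E + B) (B + A E⁻¹)`. Hence `s_n = Λ(B U_n + A
U_{n-1})` satisfies `A s_{n+1} + B s_n = 0` for `n ≥ 1`, and a bounded solution vanishes because `A
< B` (`functionalSzego_szegoPoly`). The three-term recurrence then gives the other products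
(`functionalSzego_orthogonal`).

Variance. The finite Hilbert transform sends `√(1 - y²) U_{k-1}` to `π T_k`, and `T_k' = k U_{k-1}`.
So `f ↦ P∫` is diagonal in the `T_k`, and the variance of `∑ α_k T_k` is `¼ ∑ k α_k²`
(`variance_chebyshevSum`); it is affinely invariant (`variance_affine`).

Let `p = √b + √a`, `q = √b - √a` and let `N` be the sequence `p, q, p, q, …`. For `k ≥ 1` the
coefficient of `T_k` in `∑ c_n P̂_n` is `2 d_k` with `d_k = ∑_{n ≥ k} N(n - k) c_n`, so the variance
is `∑ k d_k²`. Expanding the squares gives `R` (`kernelR_eq_sum`). The map `c ↦ d` is Toeplitz with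
symbol `(p + q z) / (1 - z²)`, and `M` has the reciprocal symbol (`upperToeplitz_alternating_mul`).
-/

open Polynomial (C X)
open Polynomial.Chebyshev (T U)

/-! ### Weighted integrals of polynomials; orthogonality of the `U_n`. -/

/-- Integration of polynomials over `[-1, 1]` against an integrable weight. -/
noncomputable def weightFunctional (w : ℝ → ℝ) (hw : IntervalIntegrable w volume (-1) 1) :
    Polynomial ℝ →ₗ[ℝ] ℝ where
  toFun Q := ∫ x in (-1 : ℝ)..1, Q.eval x * w x
  map_add' P Q := by
    rw [← intervalIntegral.integral_add (hw.continuousOn_mul P.continuous.continuousOn)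
      (hw.continuousOn_mul Q.continuous.continuousOn)]
    simp only [Polynomial.eval_add, add_mul]
  map_smul' c P := by
    simp only [Polynomial.eval_smul, smul_eq_mul, mul_assoc, RingHom.id_apply,
      intervalIntegral.integral_const_mul]

lemma weightFunctional_apply (w : ℝ → ℝ) (hw : IntervalIntegrable w volume (-1) 1)
    (Q : Polynomial ℝ) : weightFunctional w hw Q = ∫ x in (-1 : ℝ)..1, Q.eval x * w x := rfl

lemma intervalIntegrable_sqrt_one_sub_sq :
    IntervalIntegrable (fun x : ℝ => √(1 - x ^ 2)) volume (-1) 1 :=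
  Continuous.intervalIntegrable (by fun_prop) _ _

lemma intervalIntegrable_sqrt_div {κ : ℝ} (hκ : 1 < κ) :
    IntervalIntegrable (fun x : ℝ => √(1 - x ^ 2) / (x + κ)) volume (-1) 1 := by
  refine ContinuousOn.intervalIntegrable ?_
  rw [Set.uIcc_of_le (by norm_num)]
  refine ContinuousOn.div (by fun_prop) (by fun_prop) fun x hx => ?_
  linarith [hx.1]

/-- The functional `Q ↦ ∫ Q √(1 - x²)`. -/
noncomputable def functionalU : Polynomial ℝ →ₗ[ℝ] ℝ :=
  weightFunctional _ intervalIntegrable_sqrt_one_sub_sq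

/-- The functional `Q ↦ ∫ Q √(1 - x²) / (x + κ)`. -/
noncomputable def functionalSzego {κ : ℝ} (hκ : 1 < κ) : Polynomial ℝ →ₗ[ℝ] ℝ :=
  weightFunctional _ (intervalIntegrable_sqrt_div hκ)

lemma functionalSzego_mul {κ : ℝ} (hκ : 1 < κ) (Q : Polynomial ℝ) :
    functionalSzego hκ ((X + C κ) * Q) = functionalU Q := by
  simp only [functionalSzego, functionalU, weightFunctional_apply]
  refine intervalIntegral.integral_congr fun x hx => ?_
  rw [Set.uIcc_of_le (by norm_num)] at hx
  have : x + κ ≠ 0 := by linarith [hx.1]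
  simp only [Polynomial.eval_mul, Polynomial.eval_add, Polynomial.eval_X, Polynomial.eval_C]
  field_simp

/-- Converts the second-kind weight into `1 - x²` times the density of `measureT`. Where `1 - x² ≤
0` both sides vanish by the convention for square roots. -/
lemma sqrt_eq_mul_sqrt_inv (x : ℝ) : √(1 - x ^ 2) = (1 - x ^ 2) * √(1 - x ^ 2)⁻¹ := by
  rw [Real.sqrt_inv]
  rcases le_or_gt (1 - x ^ 2) 0 with h | h
  · simp [Real.sqrt_eq_zero_of_nonpos h]
  · have h1 := Real.sqrt_pos.2 h
    field_simp
    rw [Real.sq_sqrt h.le]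

/-- Product formula for Chebyshev polynomials of the second kind on `[-1, 1]`. -/
lemma two_mul_one_sub_sq_mul_U_mul_U (m n : ℤ) (θ : ℝ) :
    2 * (1 - Real.cos θ ^ 2) * ((U ℝ m).eval (Real.cos θ) * (U ℝ n).eval (Real.cos θ)) =
      (T ℝ (m - n)).eval (Real.cos θ) - (T ℝ (m + n + 2)).eval (Real.cos θ) := by
  have h1 := Polynomial.Chebyshev.U_real_cos θ m
  have h2 := Polynomial.Chebyshev.U_real_cos θ n
  rw [Polynomial.Chebyshev.T_real_cos, Polynomial.Chebyshev.T_real_cos, ← Real.sin_sq]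
  have e : 2 * Real.sin θ ^ 2 * ((U ℝ m).eval (Real.cos θ) * (U ℝ n).eval (Real.cos θ)) =
      2 * (((U ℝ m).eval (Real.cos θ) * Real.sin θ) *
        ((U ℝ n).eval (Real.cos θ) * Real.sin θ)) := by ring
  rw [e, h1, h2]
  have e1 : ((m - n : ℤ) : ℝ) * θ = ((m : ℝ) + 1) * θ - ((n : ℝ) + 1) * θ := by push_cast; ring
  have e2 : ((m + n + 2 : ℤ) : ℝ) * θ = ((m : ℝ) + 1) * θ + ((n : ℝ) + 1) * θ := by
    push_cast; ring
  rw [e1, e2, Real.cos_sub, Real.cos_add]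
  ring

lemma functionalU_eq_integral_measureT (Q : Polynomial ℝ) :
    functionalU Q = ∫ x, (1 - x ^ 2) * Q.eval x ∂Polynomial.Chebyshev.measureT := by
  rw [Polynomial.Chebyshev.integral_measureT, functionalU, weightFunctional_apply]
  refine intervalIntegral.integral_congr fun x _ => ?_
  rw [sqrt_eq_mul_sqrt_inv]
  ring

lemma integral_T_measureT (n : ℤ) :
    ∫ x, (T ℝ n).eval x ∂Polynomial.Chebyshev.measureT = if n = 0 then Real.pi else 0 := by
  split_ifs with h
  · rw [h]; exact Polynomial.Chebyshev.integral_eval_T_real_measureT_zero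
  · exact Polynomial.Chebyshev.integral_eval_T_real_measureT_of_ne_zero h

/-- Orthogonality of the Chebyshev polynomials of the second kind. -/
lemma functionalU_U_mul_U (m n : ℤ) (h : m + n + 2 ≠ 0) :
    functionalU (U ℝ m * U ℝ n) = if m = n then Real.pi / 2 else 0 := by
  have key : functionalU (U ℝ m * U ℝ n) = ∫ x, ((T ℝ (m - n)).eval x -
      (T ℝ (m + n + 2)).eval x) / 2 ∂Polynomial.Chebyshev.measureT := by
    rw [functionalU_eq_integral_measureT,
      Polynomial.Chebyshev.integral_measureT_eq_integral_cos,
      Polynomial.Chebyshev.integral_measureT_eq_integral_cos]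
    refine intervalIntegral.integral_congr fun θ _ => ?_
    rw [← two_mul_one_sub_sq_mul_U_mul_U, Polynomial.eval_mul]
    ring
  -- Only `T_0` has nonzero integral, and `h` excludes the index `m + n + 2 = 0`.
  rw [key, MeasureTheory.integral_div, MeasureTheory.integral_sub
    (Polynomial.Chebyshev.integrable_measureT (by fun_prop))
    (Polynomial.Chebyshev.integrable_measureT (by fun_prop)), integral_T_measureT,
    integral_T_measureT, if_neg h]
  by_cases hmn : m = n
  · simp [hmn]
  · rw [if_neg (by omega), if_neg hmn]; simp

lemma functionalU_U (n : ℤ) (h : n + 2 ≠ 0) :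
    functionalU (U ℝ n) = if n = 0 then Real.pi / 2 else 0 := by
  simpa using functionalU_U_mul_U n 0 (by simpa using h)

lemma abs_eval_U_mul_sqrt_le (n : ℤ) {x : ℝ} (hx : x ∈ Set.Icc (-1 : ℝ) 1) :
    |(U ℝ n).eval x * √(1 - x ^ 2)| ≤ 1 := by
  have h := Polynomial.Chebyshev.U_real_cos (Real.arccos x) n
  rw [Real.cos_arccos hx.1 hx.2, Real.sin_arccos] at h
  rw [h]
  exact Real.abs_sin_le_one _

/-- The point is uniformity in `n`: `U_n √(1 - x²)` is a sine, and `x + κ ≥ κ - 1`. -/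
lemma abs_functionalSzego_U_le {κ : ℝ} (hκ : 1 < κ) (n : ℤ) :
    |functionalSzego hκ (U ℝ n)| ≤ 2 / (κ - 1) := by
  rw [functionalSzego, weightFunctional_apply, ← Real.norm_eq_abs]
  refine (intervalIntegral.norm_integral_le_of_norm_le_const (C := 1 / (κ - 1))
    fun x hx => ?_).trans (le_of_eq ?_)
  · rw [Set.uIoc_of_le (by norm_num)] at hx
    have h1 := abs_eval_U_mul_sqrt_le n ⟨hx.1.le, hx.2⟩
    have h2 : 0 < x + κ := by linarith [hx.1]
    rw [Real.norm_eq_abs, ← mul_div_assoc, abs_div, abs_of_pos h2]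
    exact div_le_div₀ zero_le_one h1 (by linarith) (by linarith [hx.1])
  · norm_num
    ring

/-! ### Orthogonality of the Szegő polynomials. -/

/-- The unnormalized Szegő polynomial `B U_n + A U_{n-1}`. -/
noncomputable def szegoPoly (A B : ℝ) (n : ℤ) : Polynomial ℝ := C B * U ℝ n + C A * U ℝ (n - 1)

section Szego

variable {A B κ : ℝ} (hκ : 1 < κ)

/-- The factor `x + κ` cancels the denominator of the weight, while `2 x U_m = U_{m+1} + U_{m-1}`.
-/
lemma functionalSzego_recurrence (Q : Polynomial ℝ) (m : ℤ) :
    functionalSzego hκ (U ℝ (m + 1) * Q) + 2 * κ * functionalSzego hκ (U ℝ m * Q) +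
      functionalSzego hκ (U ℝ (m - 1) * Q) = 2 * functionalU (U ℝ m * Q) := by
  rw [← functionalSzego_mul hκ]
  have e : (X + C κ) * (U ℝ m * Q) = (1 / 2 : ℝ) • (U ℝ (m + 1) * Q) + κ • (U ℝ m * Q) +
      (1 / 2 : ℝ) • (U ℝ (m - 1) * Q) := by
    rw [Polynomial.Chebyshev.U_add_one]
    simp only [Polynomial.smul_eq_C_mul]
    have : (2 : Polynomial ℝ) = C (2 : ℝ) := rfl
    have h2 : C (1 / 2 : ℝ) * C (2 : ℝ) = 1 := by rw [← Polynomial.C_mul]; norm_num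
    rw [this]
    linear_combination (- X * U ℝ m * Q) * h2
  rw [e, map_add, map_add, map_smul, map_smul, map_smul]
  simp only [smul_eq_mul]
  ring

lemma map_szegoPoly_mul (Φ : Polynomial ℝ →ₗ[ℝ] ℝ) (n : ℤ) (Q : Polynomial ℝ) :
    Φ (szegoPoly A B n * Q) = B * Φ (U ℝ n * Q) + A * Φ (U ℝ (n - 1) * Q) := by
  simp only [szegoPoly, add_mul, ← Polynomial.smul_eq_C_mul, smul_mul_assoc, map_add, map_smul,
    smul_eq_mul]

lemma map_szegoPoly (Φ : Polynomial ℝ →ₗ[ℝ] ℝ) (n : ℤ) :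
    Φ (szegoPoly A B n) = B * Φ (U ℝ n) + A * Φ (U ℝ (n - 1)) := by
  simpa using map_szegoPoly_mul (A := A) (B := B) Φ n 1

variable (hA : 0 < A) (hAB : A < B) (h2 : 2 * (A * B) = 1) (hs : A ^ 2 + B ^ 2 = κ)

include h2 hs in
-- The second-order recurrence factors through `B + A E⁻¹`, leaving a first-order one: this is where
-- `2AB = 1` and `A² + B² = κ` enter.
lemma functionalSzego_szegoPoly_step (n : ℤ) :
    A * functionalSzego hκ (szegoPoly A B (n + 1)) + B * functionalSzego hκ (szegoPoly A B n) =
      functionalU (U ℝ n) := by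
  have h := functionalSzego_recurrence hκ 1 n
  simp only [mul_one] at h
  rw [map_szegoPoly, map_szegoPoly, add_sub_cancel_right]
  linear_combination h / 2 + functionalSzego hκ (U ℝ n) * hs +
    (functionalSzego hκ (U ℝ (n + 1)) + functionalSzego hκ (U ℝ (n - 1))) / 2 * h2

include hA hAB h2 hs in
-- Going up `k` indices costs a factor `(-A/B)^k`, while the values stay bounded; letting `k → ∞`
-- forces zero.
lemma functionalSzego_szegoPoly (n : ℕ) :
    functionalSzego hκ (szegoPoly A B (n + 1 : ℕ)) = 0 := by
  have hB : 0 < B := hA.trans hAB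
  have step : ∀ k : ℕ, functionalSzego hκ (szegoPoly A B (n + 1 : ℕ)) =
      (-(A / B)) ^ k * functionalSzego hκ (szegoPoly A B (n + 1 + k : ℕ)) := by
    intro k
    induction k with
    | zero => simp
    | succ k ih =>
      have h := functionalSzego_szegoPoly_step hκ h2 hs (n + 1 + k : ℕ)
      rw [functionalU_U _ (by omega), if_neg (by omega)] at h
      rw [ih, pow_succ]
      have e : ((n + 1 + k : ℕ) : ℤ) + 1 = ((n + 1 + (k + 1) : ℕ) : ℤ) := by push_cast; ring
      rw [e] at h
      have : functionalSzego hκ (szegoPoly A B (n + 1 + k : ℕ)) =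
          -(A / B) * functionalSzego hκ (szegoPoly A B (n + 1 + (k + 1) : ℕ)) := by
        field_simp
        linear_combination h
      rw [this]
      ring
  have hb : ∀ k : ℕ, |functionalSzego hκ (szegoPoly A B (n + 1 : ℕ))| ≤
      (A / B) ^ k * ((B + A) * (2 / (κ - 1))) := by
    intro k
    rw [step k, abs_mul, abs_pow, abs_neg, abs_of_pos (div_pos hA hB)]
    refine mul_le_mul_of_nonneg_left ?_ (by positivity)
    rw [map_szegoPoly]
    refine (abs_add_le _ _).trans ?_
    rw [abs_mul, abs_mul, abs_of_pos hA, abs_of_pos hB, add_mul]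
    exact add_le_add (mul_le_mul_of_nonneg_left (abs_functionalSzego_U_le _ _) hB.le)
      (mul_le_mul_of_nonneg_left (abs_functionalSzego_U_le _ _) hA.le)
  have ht : Tendsto (fun k : ℕ => (A / B) ^ k * ((B + A) * (2 / (κ - 1)))) atTop (𝓝 0) := by
    simpa using (tendsto_pow_atTop_nhds_zero_of_lt_one (div_pos hA hB).le
      ((div_lt_one hB).2 hAB)).mul_const ((B + A) * (2 / (κ - 1)))
  exact abs_eq_zero.1 (le_antisymm (ge_of_tendsto' ht hb) (abs_nonneg _))

include hA hAB h2 hs in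
-- Induction on `m` by the three-term recurrence, started from the previous lemma and `U_{-1} = 0`.
-- Its right side vanishes for `m < n`, since `U_m` is then orthogonal to both `U_{n+1}` and `U_n`.
-- Two consecutive indices are carried because the recurrence has order two.
lemma functionalSzego_U_mul_szegoPoly_aux (n m : ℕ) (hm : m ≤ n) :
    functionalSzego hκ (U ℝ m * szegoPoly A B (n + 1 : ℕ)) = 0 ∧
      functionalSzego hκ (U ℝ (m - 1) * szegoPoly A B (n + 1 : ℕ)) = 0 := by
  induction m with
  | zero => simpa using functionalSzego_szegoPoly hκ hA hAB h2 hs n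
  | succ m ih =>
    obtain ⟨h0, h1⟩ := ih (by omega)
    have h := functionalSzego_recurrence hκ (szegoPoly A B (n + 1 : ℕ)) m
    rw [h0, h1, mul_comm (U ℝ m), map_szegoPoly_mul, functionalU_U_mul_U _ _ (by omega),
      functionalU_U_mul_U _ _ (by omega), if_neg (by omega), if_neg (by omega)] at h
    refine ⟨by simpa using h, ?_⟩
    simpa using h0

include hA hAB h2 hs in
lemma functionalSzego_mul_szegoPoly_of_lt {m n : ℕ} (hmn : m < n) :
    functionalSzego hκ (szegoPoly A B m * szegoPoly A B n) = 0 := by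
  obtain ⟨n, rfl⟩ : ∃ k, n = k + 1 := ⟨n - 1, by omega⟩
  obtain ⟨h0, h1⟩ := functionalSzego_U_mul_szegoPoly_aux hκ hA hAB h2 hs n m (by omega)
  rw [map_szegoPoly_mul, h0, h1]
  simp

include hA hAB h2 hs in
lemma functionalSzego_mul_szegoPoly_self (n : ℕ) :
    functionalSzego hκ (szegoPoly A B n * szegoPoly A B n) = Real.pi / 2 := by
  rcases n with _ | n
  · have h := functionalSzego_szegoPoly_step hκ h2 hs 0
    have h1 := functionalSzego_szegoPoly hκ hA hAB h2 hs 0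
    simp only [zero_add, Nat.cast_one] at h h1
    rw [h1, functionalU_U _ (by norm_num), if_pos rfl] at h
    have e : szegoPoly A B (0 : ℕ) = C B := by simp [szegoPoly]
    have e' : szegoPoly A B 0 = C B := by simp [szegoPoly]
    rw [e'] at h
    rw [e, ← Polynomial.smul_eq_C_mul, map_smul, smul_eq_mul]
    linarith
  -- One step beyond the vanishing range, the right side of the recurrence is `2A · π/2`.
  -- Multiplying by `B` and using `2AB = 1` gives `π/2`.
  · obtain ⟨h0, h1⟩ := functionalSzego_U_mul_szegoPoly_aux hκ hA hAB h2 hs n n le_rfl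
    have h := functionalSzego_recurrence hκ (szegoPoly A B (n + 1 : ℕ)) n
    rw [h0, h1, mul_comm (U ℝ n), map_szegoPoly_mul, functionalU_U_mul_U _ _ (by omega),
      functionalU_U_mul_U _ _ (by omega), if_neg (by omega), if_pos (by simp)] at h
    have e : ((n + 1 : ℕ) : ℤ) = (n : ℤ) + 1 := by push_cast; ring
    rw [e] at h h0 ⊢
    rw [map_szegoPoly_mul, add_sub_cancel_right, h0]
    linear_combination B * h + Real.pi / 2 * h2

include hA hAB h2 hs in
lemma functionalSzego_orthogonal (m n : ℕ) :
    functionalSzego hκ (szegoPoly A B m * szegoPoly A B n) = if m = n then Real.pi / 2 else 0 := by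
  rcases lt_trichotomy m n with h | h | h
  · rw [if_neg h.ne, functionalSzego_mul_szegoPoly_of_lt hκ hA hAB h2 hs h]
  · rw [if_pos h, h, functionalSzego_mul_szegoPoly_self hκ hA hAB h2 hs]
  · rw [if_neg h.ne', mul_comm, functionalSzego_mul_szegoPoly_of_lt hκ hA hAB h2 hs h]

end Szego

/-! ### Calculus of principal values. -/

section PrincipalValue

variable {a b x : ℝ} {g g₁ g₂ : ℝ → ℝ} {L L₁ L₂ : ℝ}

lemma measurableSet_trunc (a b x ε : ℝ) :
    MeasurableSet {y : ℝ | y ∈ Set.Ioo a b ∧ ε < |x - y|} :=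
  measurableSet_Ioo.inter (measurableSet_lt measurable_const
    (measurable_const.sub measurable_id).norm)

lemma HasPrincipalValue.congr (h : HasPrincipalValue a b x g₁ L)
    (he : ∀ y ∈ Set.Ioo a b, y ≠ x → g₁ y = g₂ y) : HasPrincipalValue a b x g₂ L := by
  have hs : ∀ ε : ℝ, 0 < ε → Set.EqOn g₁ g₂ {y : ℝ | y ∈ Set.Ioo a b ∧ ε < |x - y|} := by
    rintro ε hε y ⟨hy, hy'⟩
    refine he y hy ?_
    rintro rfl
    simp only [sub_self, abs_zero] at hy'
    linarith
  refine ⟨fun ε hε => (h.1 ε hε).congr_fun (hs ε hε) (measurableSet_trunc _ _ _ _), ?_⟩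
  refine h.2.congr' ?_
  filter_upwards [self_mem_nhdsWithin] with ε hε
  exact setIntegral_congr_fun (measurableSet_trunc _ _ _ _) (hs ε hε)

lemma HasPrincipalValue.const_mul (h : HasPrincipalValue a b x g L) (c : ℝ) :
    HasPrincipalValue a b x (fun y => c * g y) (c * L) := by
  refine ⟨fun ε hε => (h.1 ε hε).const_mul c, ?_⟩
  refine (h.2.const_mul c).congr fun ε => ?_
  simp only [truncIntegral, MeasureTheory.integral_const_mul]

lemma HasPrincipalValue.add (h₁ : HasPrincipalValue a b x g₁ L₁)
    (h₂ : HasPrincipalValue a b x g₂ L₂) :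
    HasPrincipalValue a b x (fun y => g₁ y + g₂ y) (L₁ + L₂) := by
  refine ⟨fun ε hε => (h₁.1 ε hε).add (h₂.1 ε hε), ?_⟩
  refine (h₁.2.add h₂.2).congr' ?_
  filter_upwards [self_mem_nhdsWithin] with ε hε
  exact (integral_add (h₁.1 ε hε) (h₂.1 ε hε)).symm

lemma hasPrincipalValue_zero : HasPrincipalValue a b x (fun _ => 0) 0 := by
  refine ⟨fun ε _ => integrableOn_zero, ?_⟩
  have : truncIntegral a b x (fun _ => 0) = fun _ => 0 := by
    funext ε; simp [truncIntegral]
  rw [this]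
  exact tendsto_const_nhds

lemma HasPrincipalValue.sum {ι : Type*} (s : Finset ι) {g : ι → ℝ → ℝ} {L : ι → ℝ}
    (h : ∀ i ∈ s, HasPrincipalValue a b x (g i) (L i)) :
    HasPrincipalValue a b x (fun y => ∑ i ∈ s, g i y) (∑ i ∈ s, L i) := by
  classical
  induction s using Finset.induction_on with
  | empty => simpa using hasPrincipalValue_zero
  | insert i s hi ih =>
    simp only [Finset.sum_insert hi]
    exact (h i (Finset.mem_insert_self _ _)).add
      (ih fun j hj => h j (Finset.mem_insert_of_mem hj))

lemma HasPrincipalValue.principalValue_eq (h : HasPrincipalValue a b x g L) :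
    principalValue a b x g = L :=
  h.2.limUnder_eq

lemma truncIntegral_eq_add {ε : ℝ} (hε : 0 < ε) (hεa : ε < x - a) (hεb : ε < b - x)
    (hg : IntegrableOn g {y : ℝ | y ∈ Set.Ioo a b ∧ ε < |x - y|}) :
    truncIntegral a b x g ε = (∫ y in a..(x - ε), g y) + ∫ y in (x + ε)..b, g y := by
  have hset : {y : ℝ | y ∈ Set.Ioo a b ∧ ε < |x - y|} =
      Set.Ioo a (x - ε) ∪ Set.Ioo (x + ε) b := by
    ext y
    simp only [Set.mem_ofPred_eq, Set.mem_Ioo, Set.mem_union, lt_abs]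
    constructor
    · rintro ⟨⟨h1, h2⟩, h | h⟩
      · left; constructor <;> linarith
      · right; constructor <;> linarith
    · rintro (⟨h1, h2⟩ | ⟨h1, h2⟩)
      · exact ⟨⟨h1, by linarith⟩, Or.inl (by linarith)⟩
      · exact ⟨⟨by linarith, h2⟩, Or.inr (by linarith)⟩
  rw [truncIntegral, hset]
  rw [hset] at hg
  rw [setIntegral_union _ measurableSet_Ioo hg.left_of_union hg.right_of_union,
    intervalIntegral.integral_of_le (by linarith), intervalIntegral.integral_of_le (by linarith),
    integral_Ioc_eq_integral_Ioo, integral_Ioc_eq_integral_Ioo]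
  rw [Set.disjoint_left]
  rintro y ⟨_, h1⟩ ⟨h2, _⟩
  linarith

lemma eventually_trunc_small (hx : x ∈ Set.Ioo a b) :
    ∀ᶠ ε in 𝓝[>] (0 : ℝ), 0 < ε ∧ ε < x - a ∧ ε < b - x := by
  have h1 : ∀ᶠ ε in 𝓝 (0 : ℝ), ε < x - a := eventually_lt_nhds (by linarith [hx.1])
  have h2 : ∀ᶠ ε in 𝓝 (0 : ℝ), ε < b - x := eventually_lt_nhds (by linarith [hx.2])
  filter_upwards [self_mem_nhdsWithin, nhdsWithin_le_nhds h1, nhdsWithin_le_nhds h2]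
    with ε h0 h1 h2 using ⟨h0, h1, h2⟩

/-- Needed for the regular term produced by writing `y = x - (x - y)` in the Chebyshev recurrence.
-/
lemma hasPrincipalValue_of_continuous (hx : x ∈ Set.Ioo a b) (hg : Continuous g) :
    HasPrincipalValue a b x g (∫ y in a..b, g y) := by
  have hint : ∀ ε : ℝ, 0 < ε → IntegrableOn g {y : ℝ | y ∈ Set.Ioo a b ∧ ε < |x - y|} :=
    fun ε _ => (hg.integrableOn_Icc (a := a) (b := b)).mono_set
      fun y hy => Set.Ioo_subset_Icc_self hy.1
  refine ⟨hint, ?_⟩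
  have hc : Continuous fun ε : ℝ => (∫ y in a..(x - ε), g y) + ∫ y in (x + ε)..b, g y := by
    have e : ∀ ε : ℝ, (∫ y in a..(x - ε), g y) + ∫ y in (x + ε)..b, g y =
        (∫ y in a..(x - ε), g y) - ∫ y in b..(x + ε), g y := by
      intro ε
      rw [intervalIntegral.integral_symm b, ← sub_eq_add_neg]
    simp only [e]
    have hp : ∀ c : ℝ, Continuous fun u : ℝ => ∫ y in c..u, g y := fun c =>
      intervalIntegral.continuous_primitive (fun _ _ => hg.intervalIntegrable _ _) c
    exact ((hp a).comp (by fun_prop : Continuous fun ε : ℝ => x - ε)).sub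
      ((hp b).comp (by fun_prop : Continuous fun ε : ℝ => x + ε))
  have h0 := hc.tendsto 0
  simp only [sub_zero, add_zero] at h0
  rw [intervalIntegral.integral_add_adjacent_intervals (hg.intervalIntegrable _ _)
    (hg.intervalIntegrable _ _)] at h0
  refine (h0.mono_left nhdsWithin_le_nhds).congr' ?_
  filter_upwards [eventually_trunc_small hx] with ε hε
  exact (truncIntegral_eq_add hε.1 hε.2.1 hε.2.2 (hint ε hε.1)).symm

lemma integrableOn_trunc_div (hg : Continuous g) {ε : ℝ} (hε : 0 < ε) :
    IntegrableOn (fun y => g y / (x - y)) {y : ℝ | y ∈ Set.Ioo a b ∧ ε < |x - y|} := by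
  have hc : IsCompact (Set.Icc a b ∩ {y : ℝ | ε ≤ |x - y|}) :=
    isCompact_Icc.inter_right (isClosed_le continuous_const (by fun_prop))
  refine (ContinuousOn.integrableOn_compact hc ?_).mono_set
    fun y hy => ⟨Set.Ioo_subset_Icc_self hy.1, hy.2.le⟩
  refine hg.continuousOn.div (by fun_prop) ?_
  rintro y ⟨_, hy⟩ h0
  rw [Set.mem_ofPred_eq, h0, abs_zero] at hy
  linarith

end PrincipalValue

/-! ### Finite Hilbert transform of `√(1 - y²) U_n`. -/

/-- The part, regular on `[-1, 1]`, of an antiderivative of `√(1 - y²) / (x - y)`. -/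
noncomputable def semicirclePrimitive (x y : ℝ) : ℝ :=
  x * Real.arcsin y - √(1 - y ^ 2) +
    √(1 - x ^ 2) * Real.log (1 - x * y + √(1 - x ^ 2) * √(1 - y ^ 2))

section Semicircle

variable {x : ℝ} (hx : x ∈ Set.Ioo (-1 : ℝ) 1)

include hx in
lemma semicirclePrimitive_log_arg_pos {y : ℝ} (hy : y ∈ Set.Icc (-1 : ℝ) 1) :
    0 < 1 - x * y + √(1 - x ^ 2) * √(1 - y ^ 2) := by
  have h1 : x * y < 1 := by
    rcases le_total 0 y with h | h
    · nlinarith [hx.1, hx.2, hy.1, hy.2]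
    · nlinarith [hx.1, hx.2, hy.1, hy.2]
  have := mul_nonneg (Real.sqrt_nonneg (1 - x ^ 2)) (Real.sqrt_nonneg (1 - y ^ 2))
  linarith

include hx in
lemma continuousOn_semicirclePrimitive :
    ContinuousOn (semicirclePrimitive x) (Set.Icc (-1) 1) := by
  unfold semicirclePrimitive
  refine ContinuousOn.add ?_ (continuousOn_const.mul (ContinuousOn.log (by fun_prop)
    fun y hy => (semicirclePrimitive_log_arg_pos hx hy).ne'))
  exact ((continuous_const.mul Real.continuous_arcsin).sub (by fun_prop)).continuousOn

include hx in
lemma hasDerivAt_semicirclePrimitive {y : ℝ} (hy : y ∈ Set.Ioo (-1 : ℝ) 1) (hxy : y ≠ x) :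
    HasDerivAt (fun y => semicirclePrimitive x y - √(1 - x ^ 2) * Real.log (x - y))
      (√(1 - y ^ 2) / (x - y)) y := by
  have hD := semicirclePrimitive_log_arg_pos hx (Set.Ioo_subset_Icc_self hy)
  have hy2 : 0 < 1 - y ^ 2 := by nlinarith [hy.1, hy.2]
  have hx2 : 0 < 1 - x ^ 2 := by nlinarith [hx.1, hx.2]
  have hs : 0 < √(1 - y ^ 2) := Real.sqrt_pos.2 hy2
  have hss : √(1 - y ^ 2) ^ 2 = 1 - y ^ 2 := Real.sq_sqrt hy2.le
  have htt : √(1 - x ^ 2) ^ 2 = 1 - x ^ 2 := Real.sq_sqrt hx2.le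
  have hxy' : x - y ≠ 0 := sub_ne_zero.2 hxy.symm
  have d1 := (Real.hasDerivAt_arcsin hy.1.ne' hy.2.ne).const_mul x
  have d2 : HasDerivAt (fun y : ℝ => √(1 - y ^ 2)) (-(2 * y) / (2 * √(1 - y ^ 2))) y := by
    have := ((hasDerivAt_pow 2 y).const_sub 1).sqrt hy2.ne'
    simpa using this
  have d3 : HasDerivAt (fun y : ℝ => 1 - x * y + √(1 - x ^ 2) * √(1 - y ^ 2))
      (-x + √(1 - x ^ 2) * (-(2 * y) / (2 * √(1 - y ^ 2)))) y := by
    have := (((hasDerivAt_id y).const_mul x).const_sub 1).add (d2.const_mul (√(1 - x ^ 2)))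
    rw [mul_one] at this
    exact this
  have d4 : HasDerivAt (fun y : ℝ => Real.log (x - y)) (-1 / (x - y)) y :=
    ((hasDerivAt_id y).const_sub x).log hxy'
  have d := ((d1.sub d2).add ((d3.log hD.ne').const_mul (√(1 - x ^ 2)))).sub
    (d4.const_mul (√(1 - x ^ 2)))
  refine HasDerivAt.congr_deriv (f := fun y => semicirclePrimitive x y -
    √(1 - x ^ 2) * Real.log (x - y)) d ?_
  -- With the roots named `s` and `t`, clearing denominators leaves a polynomial identity modulo `s²
  -- = 1 - y²` and `t² = 1 - x²`.
  generalize √(1 - y ^ 2) = s at *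
  generalize √(1 - x ^ 2) = t at *
  obtain ⟨D, hDdef⟩ : ∃ D, D = 1 - x * y + t * s := ⟨_, rfl⟩
  rw [← hDdef] at hD ⊢
  field_simp
  subst hDdef
  linear_combination (t ^ 2 - t * s + x * y - 1) * hss + (1 - x * y) * htt

include hx in
-- The antiderivative is a function continuous at `x` minus `√(1 - x²) log |x - y|`. The logarithms
-- at `x - ε` and `x + ε` cancel, and those at the endpoints cancel against the regular part, so
-- only `x (arcsin 1 - arcsin (-1)) = π x` survives.
lemma hasPrincipalValue_semicircle :
    HasPrincipalValue (-1) 1 x (fun y => √(1 - y ^ 2) / (x - y)) (Real.pi * x) := by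
  have hint : ∀ ε : ℝ, 0 < ε → IntegrableOn (fun y => √(1 - y ^ 2) / (x - y))
      {y : ℝ | y ∈ Set.Ioo (-1 : ℝ) 1 ∧ ε < |x - y|} := fun ε hε =>
    integrableOn_trunc_div (by fun_prop) hε
  refine ⟨hint, ?_⟩
  have hftc : ∀ u v : ℝ, -1 ≤ u → u ≤ v → v ≤ 1 → x ∉ Set.Icc u v →
      ∫ y in u..v, √(1 - y ^ 2) / (x - y) =
        (semicirclePrimitive x v - √(1 - x ^ 2) * Real.log (x - v)) -
          (semicirclePrimitive x u - √(1 - x ^ 2) * Real.log (x - u)) := by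
    intro u v hu huv hv hxuv
    have hne : ∀ y ∈ Set.Icc u v, x - y ≠ 0 := fun y hy h =>
      hxuv (by rwa [sub_eq_zero.1 h])
    refine intervalIntegral.integral_eq_sub_of_hasDerivAt_of_le
      (f := fun y => semicirclePrimitive x y - √(1 - x ^ 2) * Real.log (x - y)) huv ?_ ?_ ?_
    · refine ((continuousOn_semicirclePrimitive hx).mono (Set.Icc_subset_Icc hu hv)).sub
        (continuousOn_const.mul (ContinuousOn.log (by fun_prop) hne))
    · intro y hy
      refine hasDerivAt_semicirclePrimitive hx ⟨by linarith [hy.1], by linarith [hy.2]⟩ ?_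
      rintro rfl
      exact hne y (Set.Ioo_subset_Icc_self hy) (sub_self y)
    · refine ContinuousOn.intervalIntegrable ?_
      rw [Set.uIcc_of_le huv]
      exact ContinuousOn.div (by fun_prop) (by fun_prop) hne
  have hH : ContinuousAt (semicirclePrimitive x) x :=
    (continuousOn_semicirclePrimitive hx).continuousAt (Icc_mem_nhds hx.1 hx.2)
  have h1 : Tendsto (fun ε : ℝ => semicirclePrimitive x (x - ε)) (𝓝 0)
      (𝓝 (semicirclePrimitive x x)) := by
    refine hH.tendsto.comp ?_
    simpa using (by fun_prop : Continuous fun ε : ℝ => x - ε).tendsto 0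
  have h2 : Tendsto (fun ε : ℝ => semicirclePrimitive x (x + ε)) (𝓝 0)
      (𝓝 (semicirclePrimitive x x)) := by
    refine hH.tendsto.comp ?_
    simpa using (by fun_prop : Continuous fun ε : ℝ => x + ε).tendsto 0
  have h3 := (h1.sub h2).add_const (Real.pi * x)
  rw [sub_self, zero_add] at h3
  refine (h3.mono_left nhdsWithin_le_nhds).congr' ?_
  filter_upwards [eventually_trunc_small hx] with ε hε
  obtain ⟨h0, hl, hr⟩ := hε
  rw [truncIntegral_eq_add h0 hl hr (hint ε h0),
    hftc _ _ le_rfl (by linarith) (by linarith [hx.2]) (fun h => by linarith [h.2]),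
    hftc _ _ (by linarith [hx.1]) (by linarith) le_rfl (fun h => by linarith [h.1])]
  -- `Real.log` is `log |·|`, so one antiderivative serves on both sides of `x`.
  have e1 : Real.log (x - 1) = Real.log (1 - x) := by rw [← Real.log_neg_eq_log, neg_sub]
  have e2 : Real.log (x - (x + ε)) = Real.log (x - (x - ε)) := by
    rw [← Real.log_neg_eq_log]; congr 1; ring
  have e3 : semicirclePrimitive x 1 = x * (Real.pi / 2) + √(1 - x ^ 2) * Real.log (1 - x) := by
    simp [semicirclePrimitive]
  have e4 : semicirclePrimitive x (-1) =
      -(x * (Real.pi / 2)) + √(1 - x ^ 2) * Real.log (x - -1) := by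
    simp [semicirclePrimitive, add_comm]
  rw [e1, e2, e3, e4]
  ring

include hx in
-- In `U_{n+1} = 2 y U_n - U_{n-1}` put `y = x - (x - y)`. The term in `x - y` cancels the
-- singularity and contributes `∫ U_n √(1 - y²)`, nonzero only for `n = 0`; what remains is the
-- recurrence of `T`. The correction at `n = 0` reflects `U_{-1} = 0`, whereas `T_0 = 1`.
lemma hasPrincipalValue_sqrt_mul_U_aux (n : ℕ) :
    HasPrincipalValue (-1) 1 x (fun y => √(1 - y ^ 2) / (x - y) * (U ℝ n).eval y)
        (Real.pi * (T ℝ (n + 1)).eval x) ∧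
      HasPrincipalValue (-1) 1 x (fun y => √(1 - y ^ 2) / (x - y) * (U ℝ (n - 1)).eval y)
        (Real.pi * ((T ℝ n).eval x - if n = 0 then 1 else 0)) := by
  induction n with
  | zero => exact ⟨by simpa using hasPrincipalValue_semicircle hx,
      by simpa using hasPrincipalValue_zero⟩
  | succ n ih =>
    obtain ⟨h0, h1⟩ := ih
    refine ⟨?_, by simpa using h0⟩
    have hc := hasPrincipalValue_of_continuous hx
      (by fun_prop : Continuous fun y : ℝ => (U ℝ n).eval y * √(1 - y ^ 2))
    have hv := functionalU_U n (by omega)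
    rw [functionalU, weightFunctional_apply] at hv
    rw [hv] at hc
    have h := ((h0.const_mul (2 * x)).add (hc.const_mul (-2))).add (h1.const_mul (-1))
    have hL : 2 * x * (Real.pi * (T ℝ (n + 1)).eval x) +
        -2 * (if (n : ℤ) = 0 then Real.pi / 2 else 0) +
        -1 * (Real.pi * ((T ℝ n).eval x - if n = 0 then 1 else 0)) =
        Real.pi * (T ℝ ((n + 1 : ℕ) + 1)).eval x := by
      have : ((n + 1 : ℕ) : ℤ) + 1 = (n : ℤ) + 2 := by push_cast; ring
      rw [this, Polynomial.Chebyshev.T_add_two]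
      simp only [Polynomial.eval_sub, Polynomial.eval_mul, Polynomial.eval_X,
        Polynomial.eval_ofNat, Nat.cast_eq_zero]
      split_ifs <;> ring
    rw [hL] at h
    refine h.congr fun y _ hy => ?_
    have hxy : x - y ≠ 0 := sub_ne_zero.2 hy.symm
    have : ((n + 1 : ℕ) : ℤ) = (n : ℤ) + 1 := by push_cast; ring
    rw [this, Polynomial.Chebyshev.U_add_one]
    simp only [Polynomial.eval_sub, Polynomial.eval_mul, Polynomial.eval_X,
        Polynomial.eval_ofNat]
    field_simp
    ring

include hx in
lemma hasPrincipalValue_sqrt_mul_U (n : ℕ) :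
    HasPrincipalValue (-1) 1 x (fun y => √(1 - y ^ 2) / (x - y) * (U ℝ n).eval y)
      (Real.pi * (T ℝ (n + 1)).eval x) :=
  (hasPrincipalValue_sqrt_mul_U_aux hx n).1

end Semicircle

/-! ### The variance on `[-1, 1]`. -/

/-- The functional `Q ↦ ∫ Q / √(1 - x²)`. -/
noncomputable def functionalT : Polynomial ℝ →ₗ[ℝ] ℝ :=
  weightFunctional _ Polynomial.Chebyshev.intervalIntegrable_sqrt_one_sub_sq_inv

lemma functionalT_T_mul_T (m n : ℕ) (hn : n ≠ 0) :
    functionalT (T ℝ m * T ℝ n) = if m = n then Real.pi / 2 else 0 := by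
  rw [functionalT, weightFunctional_apply, ← Polynomial.Chebyshev.integral_measureT]
  simp only [Polynomial.eval_mul]
  split_ifs with h
  · rw [h, Polynomial.Chebyshev.integral_T_real_mul_self_measureT_of_ne_zero hn]
  · exact Polynomial.Chebyshev.integral_eval_T_real_mul_eval_T_real_measureT_of_ne h

/-- The polynomial `∑_{k ≤ K} α_k T_k`. -/
noncomputable def chebyshevSum (K : ℕ) (α : ℕ → ℝ) : Polynomial ℝ :=
  ∑ k ∈ Finset.range (K + 1), α k • T ℝ k

lemma functionalT_chebyshevSum_mul (K : ℕ) (α : ℕ → ℝ) :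
    functionalT (chebyshevSum K α * chebyshevSum K fun k => k * α k) =
      Real.pi / 2 * ∑ k ∈ Finset.range (K + 1), k * α k ^ 2 := by
  rw [chebyshevSum, chebyshevSum, Finset.sum_mul_sum, Finset.mul_sum]
  simp only [map_sum, smul_mul_smul_comm, map_smul, smul_eq_mul]
  refine Finset.sum_congr rfl fun j hj => ?_
  rw [Finset.sum_eq_single_of_mem j hj]
  · rcases Nat.eq_zero_or_pos j with rfl | h
    · simp
    · rw [functionalT_T_mul_T _ _ h.ne', if_pos rfl]; ring
  · intro k _ hkj
    rcases Nat.eq_zero_or_pos k with rfl | h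
    · simp
    · rw [functionalT_T_mul_T _ _ h.ne', if_neg hkj.symm, mul_zero]

/-- Since `T_k' = k U_{k-1}`, each `T_k` is an eigenfunction of the inner operator, with eigenvalue
`π k`. -/
lemma hasPrincipalValue_innerIntegrand {x : ℝ} (hx : x ∈ Set.Ioo (-1 : ℝ) 1) (K : ℕ)
    (α : ℕ → ℝ) :
    HasPrincipalValue (-1) 1 x (innerIntegrand (-1) 1 (fun t => (chebyshevSum K α).eval t) x)
      (Real.pi * (chebyshevSum K fun k => k * α k).eval x) := by
  have hk : ∀ k : ℕ, HasPrincipalValue (-1) 1 x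
      (fun y => α k * (√(1 - y ^ 2) / (x - y) * (Polynomial.derivative (T ℝ k)).eval y))
      (α k * (k * (Real.pi * (T ℝ k).eval x))) := by
    intro k
    refine HasPrincipalValue.const_mul ?_ _
    rcases k with _ | k
    · simpa using hasPrincipalValue_zero
    · refine ((hasPrincipalValue_sqrt_mul_U hx k).const_mul ((k + 1 : ℕ) : ℝ)).congr ?_
      intro y _ _
      rw [Polynomial.Chebyshev.T_derivative_eq_U]
      simp only [Nat.cast_add, Nat.cast_one, Int.cast_add, Int.cast_natCast, Int.cast_one,
        add_sub_cancel_right, Polynomial.eval_mul, Polynomial.eval_add, Polynomial.eval_natCast,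
        Polynomial.eval_one]
      ring
  have h := HasPrincipalValue.sum (Finset.range (K + 1)) fun k _ => hk k
  have hL : ∑ k ∈ Finset.range (K + 1), α k * (k * (Real.pi * (T ℝ k).eval x)) =
      Real.pi * (chebyshevSum K fun k => k * α k).eval x := by
    simp only [chebyshevSum, Polynomial.eval_finsetSum, Polynomial.eval_smul, smul_eq_mul,
      Finset.mul_sum]
    exact Finset.sum_congr rfl fun k _ => by ring
  rw [hL] at h
  refine h.congr fun y _ _ => ?_
  have e : (1 - y) * (y - -1) = 1 - y ^ 2 := by ring
  rw [innerIntegrand, Polynomial.deriv, e, chebyshevSum, Polynomial.derivative_sum,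
    Polynomial.eval_finsetSum, Finset.mul_sum]
  refine Finset.sum_congr rfl fun k _ => ?_
  rw [Polynomial.derivative_smul, Polynomial.eval_smul, smul_eq_mul]
  ring

lemma outerIntegrand_chebyshevSum {x : ℝ} (hx : x ∈ Set.Ioo (-1 : ℝ) 1) (K : ℕ) (α : ℕ → ℝ) :
    outerIntegrand (-1) 1 (fun t => (chebyshevSum K α).eval t) x =
      Real.pi * ((chebyshevSum K α * chebyshevSum K fun k => k * α k).eval x *
        √(1 - x ^ 2)⁻¹) := by
  have e : (1 - x) * (x - -1) = 1 - x ^ 2 := by ring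
  rw [outerIntegrand, (hasPrincipalValue_innerIntegrand hx K α).principalValue_eq, e,
    Real.sqrt_inv, Polynomial.eval_mul]
  ring

/-- On `(-1, 1)` the variance is diagonal in the Chebyshev polynomials of the first kind. -/
theorem variance_chebyshevSum (K : ℕ) (α : ℕ → ℝ) :
    VarianceWellDefined (-1) 1 (fun t => (chebyshevSum K α).eval t) ∧
      variance (-1) 1 (fun t => (chebyshevSum K α).eval t) =
        1 / 4 * ∑ k ∈ Finset.range (K + 1), k * α k ^ 2 := by
  have hw := (Polynomial.Chebyshev.intervalIntegrable_sqrt_one_sub_sq_inv.continuousOn_mul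
    (chebyshevSum K α * chebyshevSum K fun k => k * α k).continuous.continuousOn).const_mul Real.pi
  refine ⟨⟨fun x hx => ⟨_, hasPrincipalValue_innerIntegrand hx K α⟩, ?_⟩, ?_⟩
  · rw [intervalIntegrable_iff_integrableOn_Ioo_of_le (by norm_num)] at hw ⊢
    exact hw.congr_fun (fun x hx => (outerIntegrand_chebyshevSum hx K α).symm) measurableSet_Ioo
  · have h := functionalT_chebyshevSum_mul K α
    rw [functionalT, weightFunctional_apply] at h
    have e : ∫ x in (-1 : ℝ)..1, outerIntegrand (-1) 1 (fun t => (chebyshevSum K α).eval t) x =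
        ∫ x in (-1 : ℝ)..1, Real.pi *
          ((chebyshevSum K α * chebyshevSum K fun k => k * α k).eval x * √(1 - x ^ 2)⁻¹) := by
      rw [intervalIntegral.integral_of_le (by norm_num),
        intervalIntegral.integral_of_le (by norm_num), integral_Ioc_eq_integral_Ioo,
        integral_Ioc_eq_integral_Ioo]
      exact setIntegral_congr_fun measurableSet_Ioo
        fun x hx => outerIntegrand_chebyshevSum hx K α
    rw [variance, e, intervalIntegral.integral_const_mul, h]
    have := Real.pi_pos
    field_simp
    ring

/-! ### Affine invariance of the variance. -/

section Affine

variable {a b : ℝ} (hab : a < b) (F : ℝ → ℝ)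

/-- The affine map from `[-1, 1]` onto `[a, b]`. -/
noncomputable def affineInv (a b ξ : ℝ) : ℝ := (b - a) / 2 * ξ + (b + a) / 2

/-- The affine map from `[a, b]` onto `[-1, 1]`. -/
noncomputable def affineMap (a b x : ℝ) : ℝ := 2 / (b - a) * x - (b + a) / (b - a)

include hab in
lemma affineMap_affineInv (ξ : ℝ) : affineMap a b (affineInv a b ξ) = ξ := by
  have : b - a ≠ 0 := (sub_pos.2 hab).ne'
  rw [affineMap, affineInv]
  field_simp
  ring

include hab in
lemma affineInv_affineMap (x : ℝ) : affineInv a b (affineMap a b x) = x := by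
  have : b - a ≠ 0 := (sub_pos.2 hab).ne'
  rw [affineMap, affineInv]
  field_simp
  ring

lemma hasDerivAt_affineInv (ξ : ℝ) : HasDerivAt (affineInv a b) ((b - a) / 2) ξ := by
  exact HasDerivAt.congr_deriv (f := affineInv a b)
    (((hasDerivAt_id ξ).const_mul ((b - a) / 2)).add_const ((b + a) / 2)) (mul_one _)

include hab in
lemma affineInv_injective : Function.Injective (affineInv a b) :=
  Function.LeftInverse.injective (affineMap_affineInv hab)

include hab in
lemma affineInv_mem_Ioo {ξ : ℝ} : affineInv a b ξ ∈ Set.Ioo a b ↔ ξ ∈ Set.Ioo (-1 : ℝ) 1 := by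
  have : 0 < b - a := sub_pos.2 hab
  simp only [affineInv, Set.mem_Ioo]
  constructor
  · rintro ⟨h1, h2⟩; constructor <;> nlinarith
  · rintro ⟨h1, h2⟩; constructor <;> nlinarith

include hab in
lemma image_affineInv {s : Set ℝ} {t : Set ℝ} (h : ∀ ξ, affineInv a b ξ ∈ s ↔ ξ ∈ t) :
    affineInv a b '' t = s := by
  ext x
  constructor
  · rintro ⟨ξ, hξ, rfl⟩; exact (h ξ).2 hξ
  · intro hx
    refine ⟨affineMap a b x, (h _).1 ?_, affineInv_affineMap hab x⟩
    rwa [affineInv_affineMap hab]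

include hab in
lemma setIntegral_affine {s t : Set ℝ} (ht : MeasurableSet t)
    (h : ∀ ξ, affineInv a b ξ ∈ s ↔ ξ ∈ t) (g : ℝ → ℝ) :
    ∫ x in s, g x = ∫ ξ in t, (b - a) / 2 * g (affineInv a b ξ) := by
  rw [← image_affineInv hab h, integral_image_eq_integral_abs_deriv_smul ht
    (fun ξ _ => (hasDerivAt_affineInv ξ).hasDerivWithinAt) (affineInv_injective hab).injOn]
  simp only [abs_of_pos (half_pos (sub_pos.2 hab)), smul_eq_mul]

include hab in
lemma integrableOn_affine {s t : Set ℝ} (ht : MeasurableSet t)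
    (h : ∀ ξ, affineInv a b ξ ∈ s ↔ ξ ∈ t) (g : ℝ → ℝ) :
    IntegrableOn g s ↔ IntegrableOn (fun ξ => (b - a) / 2 * g (affineInv a b ξ)) t := by
  rw [← image_affineInv hab h, integrableOn_image_iff_integrableOn_abs_deriv_smul ht
    (fun ξ _ => (hasDerivAt_affineInv ξ).hasDerivWithinAt) (affineInv_injective hab).injOn]
  simp only [abs_of_pos (half_pos (sub_pos.2 hab)), smul_eq_mul]

include hab in
lemma intervalIntegral_affine (g : ℝ → ℝ) :
    ∫ x in a..b, g x = ∫ ξ in (-1 : ℝ)..1, (b - a) / 2 * g (affineInv a b ξ) := by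
  rw [intervalIntegral.integral_of_le hab.le, intervalIntegral.integral_of_le (by norm_num),
    integral_Ioc_eq_integral_Ioo, integral_Ioc_eq_integral_Ioo]
  exact setIntegral_affine hab measurableSet_Ioo (fun _ => affineInv_mem_Ioo hab) g

include hab in
lemma sqrt_affine (ξ : ℝ) : √((b - affineInv a b ξ) * (affineInv a b ξ - a)) =
    (b - a) / 2 * √((1 - ξ) * (ξ - -1)) := by
  have h := (half_pos (sub_pos.2 hab)).le
  have e : (b - affineInv a b ξ) * (affineInv a b ξ - a) =
      ((b - a) / 2) ^ 2 * ((1 - ξ) * (ξ - -1)) := by rw [affineInv]; ring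
  rw [e, Real.sqrt_mul (sq_nonneg _), Real.sqrt_sq h]

include hab in
lemma deriv_comp_affineMap (η : ℝ) :
    deriv (fun x => F (affineMap a b x)) (affineInv a b η) = 2 / (b - a) * deriv F η := by
  have h1 := deriv_comp_mul_left (2 / (b - a)) (fun u => F (u - (b + a) / (b - a)))
    (affineInv a b η)
  have h2 := deriv_comp_sub_const F ((b + a) / (b - a)) (2 / (b - a) * affineInv a b η)
  have h3 := affineMap_affineInv hab η
  rw [affineMap] at h3
  simp only [affineMap]
  rw [h1, h2, h3, smul_eq_mul]

include hab in
lemma innerIntegrand_affine (ξ η : ℝ) :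
    (b - a) / 2 * innerIntegrand a b (fun x => F (affineMap a b x)) (affineInv a b ξ)
      (affineInv a b η) = innerIntegrand (-1) 1 F ξ η := by
  have h := (sub_pos.2 hab).ne'
  have e : affineInv a b ξ - affineInv a b η = (b - a) / 2 * (ξ - η) := by
    rw [affineInv, affineInv]; ring
  rw [innerIntegrand, innerIntegrand, sqrt_affine hab, deriv_comp_affineMap hab, e]
  -- On the diagonal both sides are zero, division by zero being zero; the identity thus needs no
  -- exception.
  rcases eq_or_ne ξ η with rfl | hne
  · simp
  · have := sub_ne_zero.2 hne
    field_simp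

include hab in
lemma affineInv_mem_trunc (ξ ε η : ℝ) :
    affineInv a b η ∈ {y : ℝ | y ∈ Set.Ioo a b ∧ ε < |affineInv a b ξ - y|} ↔
      η ∈ {y : ℝ | y ∈ Set.Ioo (-1 : ℝ) 1 ∧ 2 / (b - a) * ε < |ξ - y|} := by
  have h := sub_pos.2 hab
  have e : affineInv a b ξ - affineInv a b η = (b - a) / 2 * (ξ - η) := by
    rw [affineInv, affineInv]; ring
  rw [Set.mem_ofPred_eq, Set.mem_ofPred_eq, affineInv_mem_Ioo hab, e, abs_mul,
    abs_of_pos (half_pos h), div_mul_eq_mul_div, lt_div_iff₀ two_pos, div_mul_eq_mul_div,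
    div_lt_iff₀ h, mul_comm ε, mul_comm (b - a)]

include hab in
lemma truncIntegral_affine (ξ ε : ℝ) :
    truncIntegral a b (affineInv a b ξ)
      (innerIntegrand a b (fun x => F (affineMap a b x)) (affineInv a b ξ)) ε =
      truncIntegral (-1) 1 ξ (innerIntegrand (-1) 1 F ξ) (2 / (b - a) * ε) := by
  rw [truncIntegral, truncIntegral, setIntegral_affine hab (measurableSet_trunc _ _ _ _)
    (affineInv_mem_trunc hab ξ ε)]
  simp only [innerIntegrand_affine hab]

include hab in
lemma HasPrincipalValue.affine {ξ L : ℝ}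
    (h : HasPrincipalValue (-1) 1 ξ (innerIntegrand (-1) 1 F ξ) L) :
    HasPrincipalValue a b (affineInv a b ξ)
      (innerIntegrand a b (fun x => F (affineMap a b x)) (affineInv a b ξ)) L := by
  have hc : 0 < 2 / (b - a) := div_pos two_pos (sub_pos.2 hab)
  refine ⟨fun ε hε => ?_, ?_⟩
  · rw [integrableOn_affine hab (measurableSet_trunc _ _ _ _) (affineInv_mem_trunc hab ξ ε)]
    simp only [innerIntegrand_affine hab]
    exact h.1 _ (mul_pos hc hε)
  · have ht : Tendsto (fun ε : ℝ => 2 / (b - a) * ε) (𝓝[>] 0) (𝓝[>] 0) := by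
      refine tendsto_nhdsWithin_iff.2 ⟨?_, ?_⟩
      · have : Tendsto (fun ε : ℝ => 2 / (b - a) * ε) (𝓝 0) (𝓝 (2 / (b - a) * 0)) :=
          (continuous_const.mul continuous_id).tendsto 0
        rw [mul_zero] at this
        exact this.mono_left nhdsWithin_le_nhds
      · filter_upwards [self_mem_nhdsWithin] with ε hε using mul_pos hc hε
    exact (h.2.comp ht).congr fun ε => (truncIntegral_affine hab F ξ ε).symm

include hab in
/-- The variance is invariant under affine changes of variables. -/
theorem variance_affine (hF : VarianceWellDefined (-1) 1 F) :
    VarianceWellDefined a b (fun x => F (affineMap a b x)) ∧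
      variance a b (fun x => F (affineMap a b x)) = variance (-1) 1 F := by
  have hr := (sub_pos.2 hab).ne'
  -- The Jacobian `(b - a) / 2` cancels the scaling of the square root in the denominator; the
  -- principal value itself is unchanged.
  have hout : ∀ ξ ∈ Set.Ioo (-1 : ℝ) 1,
      (b - a) / 2 * outerIntegrand a b (fun x => F (affineMap a b x)) (affineInv a b ξ) =
        outerIntegrand (-1) 1 F ξ := by
    intro ξ hξ
    obtain ⟨L, hL⟩ := hF.1 ξ hξ
    rw [outerIntegrand, outerIntegrand, hL.principalValue_eq,
      (hL.affine hab).principalValue_eq, affineMap_affineInv hab, sqrt_affine hab]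
    have h1 : 0 < (1 - ξ) * (ξ - -1) := mul_pos (by linarith [hξ.2]) (by linarith [hξ.1])
    have := (Real.sqrt_pos.2 h1).ne'
    field_simp
  refine ⟨⟨fun x hx => ?_, ?_⟩, ?_⟩
  · rw [← affineInv_affineMap hab x] at hx
    obtain ⟨L, hL⟩ := hF.1 _ ((affineInv_mem_Ioo hab).1 hx)
    have := hL.affine hab
    rw [affineInv_affineMap hab] at this
    exact ⟨L, this⟩
  · have h := hF.2
    rw [intervalIntegrable_iff_integrableOn_Ioo_of_le (by norm_num)] at h
    rw [intervalIntegrable_iff_integrableOn_Ioo_of_le hab.le,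
      integrableOn_affine hab measurableSet_Ioo fun _ => affineInv_mem_Ioo hab]
    exact h.congr_fun (fun ξ hξ => (hout ξ hξ).symm) measurableSet_Ioo
  · rw [variance, variance, intervalIntegral_affine hab,
      intervalIntegral.integral_of_le (by norm_num), intervalIntegral.integral_of_le (by norm_num),
      integral_Ioc_eq_integral_Ioo, integral_Ioc_eq_integral_Ioo,
      setIntegral_congr_fun measurableSet_Ioo hout]

end Affine

/-! ### Expansion in the `T_k` and the quadratic form `R`. -/

/-- The sequence `p, q, p, q, …`. -/
noncomputable def alternating (p q : ℝ) (j : ℕ) : ℝ := if Even j then p else q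

lemma alternating_add_two (p q : ℝ) (j : ℕ) : alternating p q (j + 2) = alternating p q j := by
  simp [alternating, Nat.even_add]

/-- `U_{n+2} - U_n = 2 T_{n+2}` drives a two-step induction. The sum counts `T_0` twice, hence the
subtracted constant. -/
lemma szegoPoly_eq_sum_T (p q : ℝ) (n : ℕ) :
    szegoPoly q p n = ∑ k ∈ Finset.range (n + 1), (2 * alternating p q (n - k)) • T ℝ k -
      C (alternating p q n) := by
  induction n using Nat.twoStepInduction with
  | zero =>
    have : (C (2 : ℝ) : Polynomial ℝ) = 2 := rfl
    simp only [szegoPoly, alternating, zero_add, Finset.sum_range_one, Polynomial.smul_eq_C_mul,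
      Polynomial.C_mul, this, Nat.cast_zero, zero_sub, Polynomial.Chebyshev.U_neg_one,
      Polynomial.Chebyshev.U_zero, Polynomial.Chebyshev.T_zero, Nat.sub_self, Even.zero, if_true]
    ring
  | one =>
    have : (C (2 : ℝ) : Polynomial ℝ) = 2 := rfl
    simp [szegoPoly, alternating, Finset.sum_range_succ, Polynomial.smul_eq_C_mul, this]
    ring
  | more n ih _ =>
    have hU : ∀ m : ℤ, U ℝ (m + 2) = 2 * T ℝ (m + 2) + U ℝ m :=
      Polynomial.Chebyshev.U_eq_two_mul_T_add_U ℝ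
    have h1 : szegoPoly q p (n + 2 : ℕ) =
        szegoPoly q p n + (C p * (2 * T ℝ (n + 2)) + C q * (2 * T ℝ (n + 1))) := by
      have e1 : ((n + 2 : ℕ) : ℤ) = (n : ℤ) + 2 := by push_cast; ring
      have e2 : (n : ℤ) + 2 - 1 = (n - 1) + 2 := by ring
      have e3 : (n : ℤ) - 1 + 2 = n + 1 := by ring
      rw [szegoPoly, szegoPoly, e1, e2, hU n, hU (n - 1), e3]
      ring
    have h2 : ∀ k ∈ Finset.range (n + 1),
        (2 * alternating p q (n + 2 - k)) • T ℝ (k : ℤ) =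
          (2 * alternating p q (n - k)) • T ℝ (k : ℤ) := by
      intro k hk
      rw [Finset.mem_range] at hk
      rw [show n + 2 - k = n - k + 2 by omega, alternating_add_two]
    rw [h1, ih, Finset.sum_range_succ _ (n + 2), Finset.sum_range_succ _ (n + 1),
      Finset.sum_congr rfl h2, alternating_add_two, show n + 2 - (n + 1) = 1 by omega,
      Nat.sub_self]
    simp only [alternating, Even.zero, if_true, Nat.not_even_one, if_false,
      Polynomial.smul_eq_C_mul, Polynomial.C_mul, Nat.cast_add, Nat.cast_one, Nat.cast_ofNat]
    have : (C (2 : ℝ) : Polynomial ℝ) = 2 := rfl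
    rw [this]
    ring

/-- The coefficient `∑_{k ≤ n ≤ K} N(n - k) c_n` for the alternating sequence `N`. -/
noncomputable def diagCoeff (p q : ℝ) (K : ℕ) (c : ℕ → ℝ) (k : ℕ) : ℝ :=
  ∑ n ∈ Finset.range (K + 1), if k ≤ n then alternating p q (n - k) * c n else 0

/-- The constant `e` is left unspecified because it alters only the coefficient of `T_0`, which has
weight zero in the variance. -/
lemma sum_szegoPoly_eq (p q : ℝ) (K : ℕ) (c : ℕ → ℝ) :
    ∃ e : ℝ, ∑ n ∈ Finset.range (K + 1), c n • szegoPoly q p n =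
      ∑ k ∈ Finset.range (K + 1),
        (2 * diagCoeff p q K c k - if k = 0 then e else 0) • T ℝ k := by
  refine ⟨∑ n ∈ Finset.range (K + 1), c n * alternating p q n, ?_⟩
  have h1 : ∀ n ∈ Finset.range (K + 1), c n • szegoPoly q p n =
      ∑ k ∈ Finset.range (K + 1),
        (2 * (if k ≤ n then alternating p q (n - k) * c n else 0)) • T ℝ (k : ℤ) -
        C (c n * alternating p q n) := by
    intro n hn
    rw [Finset.mem_range] at hn
    rw [szegoPoly_eq_sum_T, smul_sub, Finset.smul_sum, ← Finset.sum_subset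
      (Finset.range_subset_range.2 (show n + 1 ≤ K + 1 by omega))]
    · congr 1
      · refine Finset.sum_congr rfl fun k hk => ?_
        rw [Finset.mem_range] at hk
        rw [if_pos (by omega), smul_smul]
        congr 1
        ring
      · rw [Polynomial.smul_C, smul_eq_mul]
    · intro k _ hk
      rw [Finset.mem_range] at hk
      rw [if_neg (by omega), mul_zero, zero_smul]
  rw [Finset.sum_congr rfl h1, Finset.sum_sub_distrib, Finset.sum_comm]
  simp only [sub_smul, Finset.sum_sub_distrib, diagCoeff, Finset.mul_sum, Finset.sum_smul]
  congr 1
  symm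
  rw [Finset.sum_eq_single_of_mem 0 (by simp)]
  · simp [Polynomial.smul_eq_C_mul, map_sum]
  · intro k _ hk
    rw [if_neg hk, zero_smul]

lemma sum_range_alternating_weight (u v : ℝ) (i : ℕ) :
    ∑ k ∈ Finset.range (2 * i + 1), (k : ℝ) * alternating u v k = u * (i * (i + 1)) + v * i ^ 2 := by
  induction i with
  | zero => simp
  | succ i ih =>
    rw [show 2 * (i + 1) + 1 = 2 * i + 1 + 1 + 1 by ring, Finset.sum_range_succ,
      Finset.sum_range_succ, ih]
    have h1 : ¬ Even (2 * i + 1) := by simp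
    have h2 : Even (2 * i + 1 + 1) := ⟨i + 1, by ring⟩
    rw [alternating, alternating, if_neg h1, if_pos h2]
    push_cast
    ring

lemma sum_range_alternating_weight_odd (u v : ℝ) (i : ℕ) :
    ∑ k ∈ Finset.range (2 * i + 1 + 1), (k : ℝ) * alternating u v k =
      u * (i * (i + 1)) + v * (i + 1) ^ 2 := by
  rw [Finset.sum_range_succ, sum_range_alternating_weight, alternating, if_neg (by simp)]
  push_cast
  ring

lemma alternating_sub (p q : ℝ) {m k : ℕ} (h : k ≤ m) :
    alternating p q (m - k) = if Even m then alternating p q k else alternating q p k := by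
  simp only [alternating, Nat.even_sub h]
  by_cases h1 : Even m <;> by_cases h2 : Even k <;> simp [h1, h2]

lemma alternating_mul (p q r s : ℝ) (k : ℕ) :
    alternating p q k * alternating r s k = alternating (p * r) (q * s) k := by
  simp only [alternating]
  split_ifs <;> rfl

lemma kernelR_comm (a b : ℝ) (m n : ℕ) : kernelR a b m n = kernelR a b n m := by
  rcases lt_trichotomy m n with h | rfl | h
  · simp only [kernelR, h.le, h, not_lt.2 h.le, not_le.2 h, if_true, if_false]
    split_ifs <;> rfl
  · rfl
  · simp only [kernelR, h.le, h, not_lt.2 h.le, not_le.2 h, if_true, if_false]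
    split_ifs <;> rfl

section Kernel

variable {a b : ℝ} (ha : 0 < a) (hab : a < b)

include ha hab in
lemma sqrt_identities : (√b + √a) ^ 2 = b + a + 2 * √(a * b) ∧
    (√b - √a) ^ 2 = b + a - 2 * √(a * b) ∧ (√b + √a) * (√b - √a) = b - a := by
  have h1 := Real.sq_sqrt ha.le
  have h2 := Real.sq_sqrt (ha.trans hab).le
  rw [Real.sqrt_mul ha.le]
  exact ⟨by linear_combination h1 + h2, by linear_combination h1 + h2,
    by linear_combination h2 - h1⟩

include ha hab in
-- By parity, `N(m - k)` is `N(k)` or its swap, so each summand is `k` times an alternating sequence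
-- with values among `p²`, `q²` and `pq`. The weighted sums are explicit, and `p² + q² = 2 (b + a)`,
-- `pq = b - a` give the closed forms.
lemma kernelR_eq_sum_of_le {m n : ℕ} (h : n ≤ m) :
    2 * ∑ k ∈ Finset.range (n + 1), (k : ℝ) *
      (alternating (√b + √a) (√b - √a) (m - k) * alternating (√b + √a) (√b - √a) (n - k)) =
      kernelR a b m n := by
  obtain ⟨hp, hq, hpq⟩ := sqrt_identities ha hab
  have e : ∀ k ∈ Finset.range (n + 1), (k : ℝ) *
      (alternating (√b + √a) (√b - √a) (m - k) * alternating (√b + √a) (√b - √a) (n - k)) =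
      k * ((if Even m then alternating (√b + √a) (√b - √a) k
        else alternating (√b - √a) (√b + √a) k) *
        if Even n then alternating (√b + √a) (√b - √a) k
        else alternating (√b - √a) (√b + √a) k) := by
    intro k hk
    rw [Finset.mem_range] at hk
    rw [alternating_sub _ _ (by omega), alternating_sub _ _ (by omega)]
  rw [Finset.sum_congr rfl e, kernelR]
  rcases Nat.even_or_odd' n with ⟨i, rfl | rfl⟩
  · have hn : Even (2 * i) := even_two_mul i
    by_cases hm : Even m
    · simp only [hm, hn, h, if_true, alternating_mul, sum_range_alternating_weight]
      push_cast
      linear_combination (2 * (i : ℝ) ^ 2) * hp + (2 * (i : ℝ) ^ 2) * hq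
    · have hlt : 2 * i < m := lt_of_le_of_ne h (by rintro rfl; exact hm hn)
      simp only [hm, hn, hlt, if_true, if_false, alternating_mul, sum_range_alternating_weight]
      push_cast
      linear_combination (2 * i * (2 * i + 1) : ℝ) * hpq
  · have hn : ¬ Even (2 * i + 1) := by simp
    by_cases hm : Even m
    · have hlt : 2 * i + 1 < m := lt_of_le_of_ne h (by rintro rfl; exact hn hm)
      simp only [hm, hn, hlt, if_true, if_false, alternating_mul,
        sum_range_alternating_weight_odd]
      push_cast
      linear_combination (2 * (i + 1) * (2 * i + 1) : ℝ) * hpq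
    · simp only [hm, hn, h, if_true, if_false, alternating_mul,
        sum_range_alternating_weight_odd]
      push_cast
      linear_combination (2 * (i : ℝ) * (i + 1)) * hq + (2 * ((i : ℝ) + 1) ^ 2 - (2 * i + 1)) * hp

include ha hab in
-- Extending by zero gives a summation range independent of `m` and `n`, as needed for interchanging
-- sums.
lemma kernelR_eq_sum {K m n : ℕ} (hm : m ≤ K) (hn : n ≤ K) :
    2 * ∑ k ∈ Finset.range (K + 1), (k : ℝ) *
      ((if k ≤ m then alternating (√b + √a) (√b - √a) (m - k) else 0) *
        if k ≤ n then alternating (√b + √a) (√b - √a) (n - k) else 0) =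
      kernelR a b m n := by
  wlog h : n ≤ m generalizing m n
  · rw [kernelR_comm, ← this hn hm (by omega)]
    congr 1
    exact Finset.sum_congr rfl fun k _ => by ring
  · rw [← kernelR_eq_sum_of_le ha hab h, ← Finset.sum_subset
      (Finset.range_subset_range.2 (show n + 1 ≤ K + 1 by omega))]
    · congr 1
      refine Finset.sum_congr rfl fun k hk => ?_
      rw [Finset.mem_range] at hk
      rw [if_pos (by omega), if_pos (by omega)]
    · intro k _ hk
      rw [Finset.mem_range] at hk
      rw [if_neg (show ¬ k ≤ n by omega), mul_zero, mul_zero]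

include ha hab in
lemma sum_diagCoeff_sq (K : ℕ) (c : ℕ → ℝ) :
    ∑ k ∈ Finset.range (K + 1), (k : ℝ) * diagCoeff (√b + √a) (√b - √a) K c k ^ 2 =
      1 / 2 * ∑ m ∈ Finset.Icc 1 K, ∑ n ∈ Finset.Icc 1 K, c m * c n * kernelR a b m n := by
  have hd : ∀ k ∈ Finset.range (K + 1), (k : ℝ) * diagCoeff (√b + √a) (√b - √a) K c k ^ 2 =
      ∑ m ∈ Finset.Icc 1 K, ∑ n ∈ Finset.Icc 1 K, c m * c n * ((k : ℝ) *
      ((if k ≤ m then alternating (√b + √a) (√b - √a) (m - k) else 0) *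
        if k ≤ n then alternating (√b + √a) (√b - √a) (n - k) else 0)) := by
    intro k _
    -- The weight kills `k = 0`; for `k ≥ 1` the term `n = 0` is absent, so sums may start at `1`.
    rcases Nat.eq_zero_or_pos k with rfl | hk
    · simp
    have e : diagCoeff (√b + √a) (√b - √a) K c k = ∑ n ∈ Finset.Icc 1 K,
        if k ≤ n then alternating (√b + √a) (√b - √a) (n - k) * c n else 0 := by
      rw [diagCoeff]
      symm
      refine Finset.sum_subset (fun n hn => ?_) fun n hn hn' => ?_
      · rw [Finset.mem_Icc] at hn; rw [Finset.mem_range]; omega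
      · rw [Finset.mem_range] at hn
        rw [Finset.mem_Icc] at hn'
        rw [if_neg (by omega)]
    rw [e, sq, Finset.sum_mul_sum, Finset.mul_sum]
    refine Finset.sum_congr rfl fun m _ => ?_
    rw [Finset.mul_sum]
    refine Finset.sum_congr rfl fun n _ => ?_
    split_ifs <;> ring
  rw [Finset.sum_congr rfl hd, Finset.sum_comm, Finset.mul_sum]
  refine Finset.sum_congr rfl fun m hm => ?_
  rw [Finset.sum_comm, Finset.mul_sum]
  refine Finset.sum_congr rfl fun n hn => ?_
  rw [Finset.mem_Icc] at hm hn
  rw [← Finset.mul_sum, ← kernelR_eq_sum ha hab hm.2 hn.2]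
  ring

end Kernel

/-! ### Inversion of the Toeplitz matrix by generating functions. -/

section Toeplitz

/-- The upper-triangular Toeplitz matrix with entries `f (j - i)`. -/
def upperToeplitz (f : ℕ → ℝ) (K : ℕ) : Matrix (Fin K) (Fin K) ℝ :=
  Matrix.of fun i j => if i ≤ j then f ((j : ℕ) - (i : ℕ)) else 0

/-- Only intermediate indices `i ≤ k ≤ j` contribute, so the matrix product is a Cauchy product of
sequences, as for power series. -/
lemma upperToeplitz_mul (f g : ℕ → ℝ) (K : ℕ) :
    upperToeplitz f K * upperToeplitz g K = upperToeplitz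
      (fun n => ∑ x ∈ Finset.HasAntidiagonal.antidiagonal n, f x.1 * g x.2) K := by
  ext i j
  simp only [Matrix.mul_apply, upperToeplitz, Matrix.of_apply, Fin.le_def]
  have e : ∑ k : Fin K, ((if (i : ℕ) ≤ k then f (k - i) else 0) *
      if (k : ℕ) ≤ j then g (j - k) else 0) = ∑ k ∈ Finset.range K,
      ((if (i : ℕ) ≤ k then f (k - i) else 0) * if k ≤ (j : ℕ) then g (j - k) else 0) :=
    Fin.sum_univ_eq_sum_range (fun k => (if (i : ℕ) ≤ k then f (k - i) else 0) *
      if k ≤ (j : ℕ) then g (j - k) else 0) K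
  rw [e]
  split_ifs with hij
  · rw [Finset.Nat.sum_antidiagonal_eq_sum_range_succ (fun x y => f x * g y),
      ← Finset.sum_subset (s₁ := Finset.Ico (i : ℕ) (j + 1))]
    · rw [Finset.sum_Ico_eq_sum_range, show (j : ℕ) + 1 - i = j - i + 1 by omega]
      refine Finset.sum_congr rfl fun k hk => ?_
      rw [Finset.mem_range] at hk
      rw [if_pos (by omega), if_pos (by omega), Nat.add_sub_cancel_left, Nat.sub_add_eq]
    · intro k hk
      rw [Finset.mem_Ico] at hk
      rw [Finset.mem_range]
      omega
    · intro k _ hk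
      rw [Finset.mem_Ico] at hk
      by_cases h : (i : ℕ) ≤ k
      · rw [if_neg (show ¬ k ≤ (j : ℕ) by omega), mul_zero]
      · rw [if_neg h, zero_mul]
  · refine Finset.sum_eq_zero fun k _ => ?_
    by_cases h : (i : ℕ) ≤ k
    · rw [if_neg (show ¬ k ≤ (j : ℕ) by omega), mul_zero]
    · rw [if_neg h, zero_mul]

variable {a b : ℝ} (ha : 0 < a) (hab : a < b)

lemma mk_alternating_mul (p q : ℝ) :
    PowerSeries.mk (alternating p q) * (1 - PowerSeries.X ^ 2) =
      PowerSeries.C p + PowerSeries.C q * PowerSeries.X := by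
  ext n
  rw [mul_sub, mul_one, map_sub, PowerSeries.coeff_mk]
  rcases n with _ | _ | n
  · simp [alternating, PowerSeries.coeff_mul_X_pow']
  · simp [alternating, PowerSeries.coeff_mul_X_pow', PowerSeries.coeff_C]
  · rw [show n + 1 + 1 = n + 2 from rfl, PowerSeries.coeff_mul_X_pow, PowerSeries.coeff_mk,
      alternating_add_two]
    simp

include ha hab in
-- From index `2` on the coefficients are geometric with ratio `-q/p`, so all coefficients of the
-- product from `3` on vanish. The coefficient at `2` uses `p² - q² = 4 √(ab)`.
lemma mk_toeplitzCoeff_mul :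
    PowerSeries.mk (toeplitzCoeff a b) *
      (PowerSeries.C (√b + √a) + PowerSeries.C (√b - √a) * PowerSeries.X) =
      1 - PowerSeries.X ^ 2 := by
  have hp : 0 < √b + √a :=
    add_pos (Real.sqrt_pos.2 (ha.trans hab)) (Real.sqrt_pos.2 ha)
  ext n
  rw [mul_add, ← mul_assoc, map_add, mul_comm _ (PowerSeries.C (√b + √a)),
    PowerSeries.coeff_C_mul, mul_comm _ (PowerSeries.C (√b - √a)), mul_assoc,
    PowerSeries.coeff_C_mul, PowerSeries.coeff_mk]
  rcases n with _ | _ | _ | n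
  · simp [toeplitzCoeff]
    field_simp
  · rw [PowerSeries.coeff_succ_mul_X, PowerSeries.coeff_mk]
    simp [toeplitzCoeff, PowerSeries.coeff_one, PowerSeries.coeff_X_pow]
    field_simp
    ring
  · rw [PowerSeries.coeff_succ_mul_X, PowerSeries.coeff_mk]
    simp [toeplitzCoeff, PowerSeries.coeff_one, PowerSeries.coeff_X_pow]
    field_simp
    linear_combination (-4) * Real.sqrt_mul ha.le b
  · rw [PowerSeries.coeff_succ_mul_X, PowerSeries.coeff_mk]
    simp [toeplitzCoeff, PowerSeries.coeff_one, PowerSeries.coeff_X_pow]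
    field_simp
    ring

include ha hab in
lemma upperToeplitz_alternating_mul (K : ℕ) :
    upperToeplitz (alternating (√b + √a) (√b - √a)) K * toeplitzMatrix a b K = 1 := by
  have hM : toeplitzMatrix a b K = upperToeplitz (toeplitzCoeff a b) K := rfl
  -- The symbols `(p + q z) / (1 - z²)` and `(1 - z²) / (p + q z)` are compared without inverses, by
  -- cancelling `1 - z²`.
  have hne : (1 - PowerSeries.X ^ 2 : PowerSeries ℝ) ≠ 0 := by
    intro h
    simpa [PowerSeries.coeff_X_pow] using congrArg (PowerSeries.coeff 0) h
  have hps : PowerSeries.mk (alternating (√b + √a) (√b - √a)) *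
      PowerSeries.mk (toeplitzCoeff a b) = 1 := by
    refine mul_right_cancel₀ hne ?_
    rw [one_mul, mul_right_comm, mk_alternating_mul, mul_comm, mk_toeplitzCoeff_mul ha hab]
  rw [hM, upperToeplitz_mul]
  ext i j
  have hc := congrArg (PowerSeries.coeff ((j : ℕ) - i)) hps
  simp only [PowerSeries.coeff_mul, PowerSeries.coeff_mk, PowerSeries.coeff_one] at hc
  simp only [upperToeplitz, Matrix.of_apply, hc, Matrix.one_apply, Fin.le_def, Fin.ext_iff]
  split_ifs <;> first | rfl | omega

include ha hab in
lemma isUnit_det_toeplitzMatrix (K : ℕ) : IsUnit (toeplitzMatrix a b K).det :=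
  Matrix.isUnit_det_of_left_inverse (upperToeplitz_alternating_mul ha hab K)

/-- Matrix index `i` stands for `i + 1`; the term `n = 0` drops out, and differences of indices are
unaffected by the shift. -/
lemma diagCoeff_eq_mulVec (p q : ℝ) (K : ℕ) (c : ℕ → ℝ) (i : Fin K) :
    diagCoeff p q K c (i + 1) =
      (upperToeplitz (alternating p q) K).mulVec (fun j : Fin K => c (j + 1)) i := by
  simp only [diagCoeff, Matrix.mulVec, dotProduct, upperToeplitz, Matrix.of_apply, Fin.le_def,
    ite_mul, zero_mul]
  rw [Finset.sum_range_succ', if_neg (by omega), add_zero,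
    ← Fin.sum_univ_eq_sum_range (fun n => if (i : ℕ) + 1 ≤ n + 1 then
      alternating p q (n + 1 - (i + 1)) * c (n + 1) else 0)]
  simp only [Nat.add_le_add_iff_right, Nat.add_sub_add_right]

include ha hab in
lemma sum_diagCoeff_sq_of_toeplitz (K : ℕ) (c : ℕ → ℝ) (d : Fin K → ℝ)
    (h : (fun i : Fin K => c ((i : ℕ) + 1)) = (toeplitzMatrix a b K).mulVec d) :
    ∑ k ∈ Finset.range (K + 1), (k : ℝ) * diagCoeff (√b + √a) (√b - √a) K c k ^ 2 =
      ∑ i : Fin K, ((i : ℕ) + 1 : ℝ) * d i ^ 2 := by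
  rw [Finset.sum_range_succ', Nat.cast_zero, zero_mul, add_zero,
    ← Fin.sum_univ_eq_sum_range (fun k => ((k + 1 : ℕ) : ℝ) *
      diagCoeff (√b + √a) (√b - √a) K c (k + 1) ^ 2)]
  refine Finset.sum_congr rfl fun i _ => ?_
  rw [diagCoeff_eq_mulVec, h, Matrix.mulVec_mulVec, upperToeplitz_alternating_mul ha hab,
    Matrix.one_mulVec]
  push_cast
  rfl

end Toeplitz

/-! ### Return to `h`, `P_n` and `P̂_n`. -/

section Main

variable {a b : ℝ} (ha : 0 < a) (hab : a < b)

include ha hab in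
-- All that the orthogonality argument needs from `h`: `A < B` puts its zero outside the closed unit
-- disc, and the last two identities encode `|h(e^{iθ})|² = cos θ + κ`.
lemma coeffAB_properties : 0 < coeffA a b ∧ coeffA a b < coeffB a b ∧
    2 * (coeffA a b * coeffB a b) = 1 ∧
    coeffA a b ^ 2 + coeffB a b ^ 2 = (b + a) / (b - a) := by
  obtain ⟨hp, hq, hpq⟩ := sqrt_identities ha hab
  have hba := sub_pos.2 hab
  have hs : 0 < √(2 * (b - a)) := Real.sqrt_pos.2 (by linarith)
  have hss : √(2 * (b - a)) ^ 2 = 2 * (b - a) := Real.sq_sqrt (by linarith)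
  have h1 : √a < √b := Real.sqrt_lt_sqrt ha.le hab
  have h2 : 0 < √a := Real.sqrt_pos.2 ha
  refine ⟨div_pos (by linarith) hs, div_lt_div_of_pos_right (by linarith) hs, ?_, ?_⟩
  · rw [coeffA, coeffB, div_mul_div_comm, ← sq, hss, mul_comm (√b - √a), hpq]
    field_simp
  · rw [coeffA, coeffB, div_pow, div_pow, hss, hp, hq]
    field_simp
    ring

include ha hab in
lemma one_lt_kappa : 1 < (b + a) / (b - a) := by
  rw [one_lt_div (sub_pos.2 hab)]
  linarith

lemma eval_affinePoly (x : ℝ) : (affinePoly a b).eval x = affineMap a b x := by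
  simp [affinePoly, affineMap]

lemma X_mul_U_sub_T (n : ℤ) : X * U ℝ n - T ℝ (n + 1) = U ℝ (n - 1) := by
  have h1 := Polynomial.Chebyshev.U_eq_X_mul_U_add_T ℝ n
  have h2 := Polynomial.Chebyshev.U_add_one ℝ n
  linear_combination h1 - h2

lemma polyP_eq_smul (n : ℕ) :
    polyP a b n = √(2 / Real.pi) • szegoPoly (coeffA a b) (coeffB a b) n := by
  rw [polyP, szegoPoly, ← X_mul_U_sub_T, Polynomial.smul_eq_C_mul]
  ring

include ha hab in
lemma hatP_eq_comp (n : ℕ) :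
    hatP a b n = (szegoPoly (√b - √a) (√b + √a) n).comp (affinePoly a b) := by
  obtain ⟨hp, -, hpq⟩ := sqrt_identities ha hab
  have hp0 : 0 < √b + √a :=
    add_pos (Real.sqrt_pos.2 (ha.trans hab)) (Real.sqrt_pos.2 ha)
  have hq0 : 0 < √b - √a := sub_pos.2 (Real.sqrt_lt_sqrt ha.le hab)
  refine Polynomial.funext fun x => ?_
  rw [hatP, szegoPoly, hatU, hatT, ← X_mul_U_sub_T, Nat.cast_add, Nat.cast_one]
  simp only [Polynomial.eval_sub, Polynomial.eval_mul, Polynomial.eval_add, Polynomial.eval_C,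
    Polynomial.eval_X, Polynomial.eval_comp]
  -- With `b - a = pq`, the affine map times `q` is `(2x - (b + a)) / p`, and `p² - (b + a) = 2
  -- √(ab)`.
  have e : 2 / (√b + √a) * (x + √(a * b)) =
      (√b + √a) + (√b - √a) * (affinePoly a b).eval x := by
    rw [eval_affinePoly, affineMap, ← hpq]
    field_simp
    linear_combination -hp
  rw [e]
  ring

include ha hab in
lemma szegoPoly_sqrt_eq (n : ℤ) : szegoPoly (√b - √a) (√b + √a) n =
    √(2 * (b - a)) • szegoPoly (coeffA a b) (coeffB a b) n := by
  have hs : √(2 * (b - a)) ≠ 0 := (Real.sqrt_pos.2 (by linarith)).ne'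
  have hA : √b - √a = √(2 * (b - a)) * coeffA a b := by rw [coeffA]; field_simp
  have hB : √b + √a = √(2 * (b - a)) * coeffB a b := by rw [coeffB]; field_simp
  rw [hA, hB, szegoPoly, szegoPoly, Polynomial.smul_eq_C_mul, Polynomial.C_mul, Polynomial.C_mul]
  ring

include ha hab in
lemma eval_hatP (n : ℕ) (x : ℝ) :
    (hatP a b n).eval x = √(Real.pi * (b - a)) * (polyP a b n).eval (affineMap a b x) := by
  have hc : √(2 * (b - a)) = √(Real.pi * (b - a)) * √(2 / Real.pi) := by
    rw [← Real.sqrt_mul (mul_pos Real.pi_pos (sub_pos.2 hab)).le]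
    congr 1
    have := Real.pi_pos
    field_simp
  rw [hatP_eq_comp ha hab, szegoPoly_sqrt_eq ha hab, polyP_eq_smul, Polynomial.eval_comp,
    eval_affinePoly, Polynomial.eval_smul, Polynomial.eval_smul, hc, smul_eq_mul, smul_eq_mul,
    mul_assoc]

lemma natDegree_szegoPoly {A B : ℝ} (hB : B ≠ 0) (n : ℕ) : (szegoPoly A B n).natDegree = n := by
  have h1 : (C B * U ℝ n).natDegree = n := by
    rw [Polynomial.natDegree_C_mul hB, Polynomial.Chebyshev.natDegree_U_natCast]
  rcases n with _ | n
  · simp [szegoPoly]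
  · have h2 : (C A * U ℝ ((n + 1 : ℕ) - 1 : ℤ)).natDegree < n + 1 := by
      rw [Nat.cast_add, Nat.cast_one, add_sub_cancel_right]
      exact (Polynomial.natDegree_C_mul_le _ _).trans_lt
        (by rw [Polynomial.Chebyshev.natDegree_U_natCast]; omega)
    rw [szegoPoly, Polynomial.natDegree_add_eq_left_of_natDegree_lt (by rwa [h1]), h1]

include ha hab in
lemma natDegree_hatP (n : ℕ) : (hatP a b n).natDegree = n := by
  have hp0 : √b + √a ≠ 0 :=
    (add_pos (Real.sqrt_pos.2 (ha.trans hab)) (Real.sqrt_pos.2 ha)).ne'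
  have hd : (affinePoly a b).natDegree = 1 := by
    rw [affinePoly, sub_eq_add_neg, ← Polynomial.C_neg]
    exact Polynomial.natDegree_linear (div_ne_zero two_ne_zero (sub_pos.2 hab).ne')
  rw [hatP_eq_comp ha hab, Polynomial.natDegree_comp, natDegree_szegoPoly hp0, hd, mul_one]

lemma szegoHCircle_eq (θ : ℝ) : szegoHCircle a b θ =
    ⟨coeffA a b * Real.cos θ + coeffB a b, coeffA a b * Real.sin θ⟩ := by
  rw [szegoHCircle, szegoH]
  simp only [map_add, map_mul, Polynomial.aeval_C, Polynomial.aeval_X, Complex.coe_algebraMap]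
  apply Complex.ext <;> simp [Complex.exp_ofReal_mul_I_re, Complex.exp_ofReal_mul_I_im]

include ha hab in
lemma cos_add_kappa_eq (θ : ℝ) :
    Real.cos θ + (b + a) / (b - a) = ‖szegoHCircle a b θ‖ ^ 2 := by
  obtain ⟨-, -, h2, hs⟩ := coeffAB_properties ha hab
  rw [szegoHCircle_eq, ← Complex.normSq_eq_norm_sq, Complex.normSq_mk]
  linear_combination -hs - Real.cos θ * h2 - coeffA a b ^ 2 * Real.sin_sq_add_cos_sq θ

lemma eval_polyP_cos (n : ℕ) {θ : ℝ} (hθ : Real.sin θ ≠ 0) :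
    (polyP a b n).eval (Real.cos θ) =
      √(2 / Real.pi) *
        ((szegoHCircle a b θ).re * (Real.sin ((n + 1) * θ) / Real.sin θ) -
          (szegoHCircle a b θ).im * (Real.cos ((n + 1) * θ) / Real.sin θ)) := by
  have hU := Polynomial.Chebyshev.U_real_cos θ n
  have hT := Polynomial.Chebyshev.T_real_cos θ (n + 1)
  push_cast at hU hT
  rw [szegoHCircle_eq, polyP, ← hU, ← hT]
  simp only [Polynomial.eval_sub, Polynomial.eval_mul, Polynomial.eval_add, Polynomial.eval_C,
    Polynomial.eval_X]
  field_simp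

include ha hab in
-- At a zero `A |z| = B`, which is impossible for `|z| < 1` as `A < B`.
lemma aeval_szegoH_ne_zero (z : ℂ) (hz : ‖z‖ < 1) : Polynomial.aeval z (szegoH a b) ≠ 0 := by
  obtain ⟨hA, hAB, -, -⟩ := coeffAB_properties ha hab
  intro h
  simp only [szegoH, map_add, map_mul, Polynomial.aeval_C, Polynomial.aeval_X,
    Complex.coe_algebraMap] at h
  have h1 := congrArg norm (eq_neg_of_add_eq_zero_left h)
  rw [norm_mul, norm_neg, Complex.norm_real, Complex.norm_real, Real.norm_eq_abs,
    Real.norm_eq_abs, abs_of_pos hA, abs_of_pos (hA.trans hAB)] at h1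
  nlinarith [norm_nonneg z]

include ha hab in
lemma integral_polyP_mul_polyP (m n : ℕ) :
    ∫ τ in (-1 : ℝ)..1, (polyP a b m).eval τ * (polyP a b n).eval τ *
        (√(1 - τ ^ 2) / (τ + (b + a) / (b - a))) = if m = n then 1 else 0 := by
  obtain ⟨hA, hAB, h2, hs⟩ := coeffAB_properties ha hab
  have h := functionalSzego_orthogonal (one_lt_kappa ha hab) hA hAB h2 hs m n
  have e : functionalSzego (one_lt_kappa ha hab) (polyP a b m * polyP a b n) =
      if m = n then 1 else 0 := by
    have hpi := Real.pi_pos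
    rw [polyP_eq_smul, polyP_eq_smul, smul_mul_smul_comm, map_smul, h, smul_eq_mul,
      Real.mul_self_sqrt (by positivity)]
    split_ifs
    · field_simp
    · rw [mul_zero]
  rw [functionalSzego, weightFunctional_apply] at e
  simpa only [Polynomial.eval_mul] using e

include ha hab in
lemma integral_hatP_mul_hatP (m n : ℕ) :
    ∫ x in a..b, (hatP a b m).eval x * (hatP a b n).eval x * (√((b - x) * (x - a)) / x) =
      if m = n then Real.pi * (b - a) ^ 2 / 2 else 0 := by
  have hba := sub_pos.2 hab
  have hκ := one_lt_kappa ha hab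
  -- The constant is `π (b - a)` from the two polynomials times `(b - a) / 2`: the Jacobian and the
  -- square root each give `(b - a) / 2`, and the denominator `x = (b - a) / 2 · (τ + κ)` removes
  -- one of them.
  have e : ∫ x in a..b, (hatP a b m).eval x * (hatP a b n).eval x *
      (√((b - x) * (x - a)) / x) = ∫ τ in (-1 : ℝ)..1, Real.pi * (b - a) ^ 2 / 2 *
        ((polyP a b m).eval τ * (polyP a b n).eval τ *
        (√(1 - τ ^ 2) / (τ + (b + a) / (b - a)))) := by
    rw [intervalIntegral_affine hab]
    refine intervalIntegral.integral_congr fun τ hτ => ?_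
    rw [Set.uIcc_of_le (by norm_num)] at hτ
    have e1 : affineInv a b τ = (b - a) / 2 * (τ + (b + a) / (b - a)) := by
      rw [affineInv]; field_simp
    have e2 : (1 - τ) * (τ - -1) = 1 - τ ^ 2 := by ring
    have hsq := Real.mul_self_sqrt (mul_pos Real.pi_pos hba).le
    have hne : τ + (b + a) / (b - a) ≠ 0 := by linarith [hτ.1]
    rw [eval_hatP ha hab, eval_hatP ha hab, affineMap_affineInv hab, sqrt_affine hab, e2, e1]
    generalize τ + (b + a) / (b - a) = ρ at *
    generalize √(Real.pi * (b - a)) = σ at *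
    field_simp
    linear_combination (polyP a b m).eval τ * (polyP a b n).eval τ * √(1 - τ ^ 2) * hsq
  rw [e, intervalIntegral.integral_const_mul, integral_polyP_mul_polyP ha hab]
  split_ifs <;> simp

include ha hab in
lemma expansion_eq (K : ℕ) (c : ℕ → ℝ) : ∃ e : ℝ, expansion a b K c = fun x =>
    (chebyshevSum K fun k => 2 * diagCoeff (√b + √a) (√b - √a) K c k -
      if k = 0 then e else 0).eval (affineMap a b x) := by
  obtain ⟨e, he⟩ := sum_szegoPoly_eq (√b + √a) (√b - √a) K c
  refine ⟨e, funext fun x => ?_⟩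
  rw [chebyshevSum, ← he, expansion, Polynomial.eval_finsetSum]
  refine Finset.sum_congr rfl fun n _ => ?_
  rw [hatP_eq_comp ha hab, Polynomial.eval_comp, eval_affinePoly, Polynomial.eval_smul,
    smul_eq_mul]

include ha hab in
lemma variance_expansion (K : ℕ) (c : ℕ → ℝ) :
    VarianceWellDefined a b (expansion a b K c) ∧
      variance a b (expansion a b K c) =
        ∑ k ∈ Finset.range (K + 1), (k : ℝ) * diagCoeff (√b + √a) (√b - √a) K c k ^ 2 := by
  obtain ⟨e, he⟩ := expansion_eq ha hab K c
  obtain ⟨h1, h2⟩ := variance_chebyshevSum K fun k =>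
    2 * diagCoeff (√b + √a) (√b - √a) K c k - if k = 0 then e else 0
  obtain ⟨h3, h4⟩ := variance_affine hab _ h1
  rw [he]
  refine ⟨h3, ?_⟩
  rw [h4, h2, Finset.mul_sum]
  refine Finset.sum_congr rfl fun k _ => ?_
  -- Only `k = 0` involves `e`, and there the weight is zero; otherwise the `¼` absorbs the square
  -- of the `2`.
  split_ifs with hk
  · simp [hk]
  · ring

end Main

theorem mainTheorem3 (a b : ℝ) (ha : 0 < a) (hab : a < b) :
    -- the factorization `ρ(cos θ) = |h(e^{iθ})|²` and the resulting form of `P_n`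
    (szegoH a b).natDegree = 1 ∧
    (∀ z : ℂ, ‖z‖ < 1 → Polynomial.aeval z (szegoH a b) ≠ 0) ∧
    0 < (szegoH a b).eval 0 ∧
    (∀ θ : ℝ, Real.cos θ + (b + a) / (b - a) = ‖szegoHCircle a b θ‖ ^ 2) ∧
    (∀ (n : ℕ) (θ : ℝ), Real.sin θ ≠ 0 →
      (polyP a b n).eval (Real.cos θ) =
        √(2 / Real.pi) *
          ((szegoHCircle a b θ).re * (Real.sin ((n + 1) * θ) / Real.sin θ) -
            (szegoHCircle a b θ).im * (Real.cos ((n + 1) * θ) / Real.sin θ))) ∧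
    (∀ m n : ℕ,
      ∫ τ in (-1 : ℝ)..1, (polyP a b m).eval τ * (polyP a b n).eval τ *
          (√(1 - τ ^ 2) / (τ + (b + a) / (b - a))) =
        if m = n then 1 else 0) ∧
    -- the polynomials `P̂_n` and their orthogonality
    (∀ n : ℕ, (hatP a b n).natDegree = n) ∧
    (∀ (n : ℕ) (x : ℝ),
      (hatP a b n).eval x =
        √(Real.pi * (b - a)) * (polyP a b n).eval (2 / (b - a) * x - (b + a) / (b - a))) ∧
    (∀ m n : ℕ,
      ∫ x in a..b, (hatP a b m).eval x * (hatP a b n).eval x *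
          (√((b - x) * (x - a)) / x) =
        if m = n then Real.pi * (b - a) ^ 2 / 2 else 0) ∧
    -- the variance as a quadratic form in the coefficients
    (∀ (K : ℕ) (c : ℕ → ℝ),
      VarianceWellDefined a b (expansion a b K c) ∧
      variance a b (expansion a b K c) =
        1 / 2 * ∑ m ∈ Finset.Icc 1 K, ∑ n ∈ Finset.Icc 1 K, c m * c n * kernelR a b m n) ∧
    -- the diagonalization
    (∀ K : ℕ, IsUnit (toeplitzMatrix a b K).det) ∧
    (∀ (K : ℕ) (c : ℕ → ℝ) (d : Fin K → ℝ),
      (fun i : Fin K => c ((i : ℕ) + 1)) = (toeplitzMatrix a b K).mulVec d →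
      variance a b (expansion a b K c) = ∑ i : Fin K, ((i : ℕ) + 1 : ℝ) * d i ^ 2) := by
  obtain ⟨hA, hAB, -, -⟩ := coeffAB_properties ha hab
  refine ⟨Polynomial.natDegree_linear hA.ne', aeval_szegoH_ne_zero ha hab, ?_,
    cos_add_kappa_eq ha hab, fun n θ hθ => eval_polyP_cos n hθ, integral_polyP_mul_polyP ha hab,
    natDegree_hatP ha hab, eval_hatP ha hab, integral_hatP_mul_hatP ha hab, fun K c => ?_,
    isUnit_det_toeplitzMatrix ha hab, fun K c d h => ?_⟩
  · simpa [szegoH] using hA.trans hAB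
  · obtain ⟨h1, h2⟩ := variance_expansion ha hab K c
    exact ⟨h1, h2.trans (sum_diagCoeff_sq ha hab K c)⟩
  · exact (variance_expansion ha hab K c).2.trans (sum_diagCoeff_sq_of_toeplitz ha hab K c d h)
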